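/- Let $\mathbb D$, $\mathbb T$ be the open unit disc and the unit circle in $\mathbb C$, let $dA$ be normalized area measure on $\mathbb D$, and let $\mu_1,\mu_2$ be finite positive Borel measures on $\overline{\mathbb D}$. For such a measure $\mu$ put $$U_\mu(w)=\int_{\mathbb D}\log\left|\frac{1-\overline\zeta w}{w-\zeta}\right|^2\frac{d\mu(\zeta)}{1-|\zeta|^2}+\int_{\mathbb T}\frac{1-|w|^2}{|\zeta-w|^2}\,d\mu(\zeta),\qquad w\in\mathbb D.$$ For $f$ holomorphic on $\mathbb D^2$ let $$\mathcal D_{\mu_1,\mu_2}(f)=\sup_{0<r<1}\int_0^{2\pi}\!\!\int_{\mathbb D}|\partial_1 f(z_1,re^{i\theta})|^2U_{\mu_1}(z_1)\,dA(z_1)\frac{d\theta}{2\pi}+\sup_{0<r<1}\int_0^{2\pi}\!\!\int_{\mathbb D}|\partial_2 f(re^{i\theta},z_2)|^2U_{\mu_2}(z_2)\,dA(z_2)\frac{d\theta}{2\pi},$$ and let $\mathcal D(\mu_1,\mu_2)=\{f\in H^2(\mathbb D^2):\mathcal D_{\mu_1,\mu_2}(f)<\infty\}$ with the norm $\|f\|^2=\|f\|^2_{H^2(\mathbb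 D^2)}+\mathcal D_{\mu_1,\mu_2}(f)$, where $H^2(\mathbb D^2)$ is the Hardy space of holomorphic functions on $\mathbb D^2$ with $$\|f\|^2_{H^2(\mathbb D^2)}=\sup_{0<r<1}\int_0^{2\pi}\!\!\int_0^{2\pi}|f(re^{is},re^{it})|^2\frac{dt}{2\pi}\frac{ds}{2\pi}<\infty.$$ Then, for $j=1,2$, multiplication by the coordinate function $z_j$, $f\mapsto z_jf$, maps $\mathcal D(\mu_1,\mu_2)$ into itself and is a bounded linear operator on $\mathcal D(\mu_1,\mu_2)$. -/

import Mathlib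

open MeasureTheory
open scoped ENNReal

noncomputable section

namespace BidiscDirichlet

/-- The open unit bidisc in `ℂ²`. -/
def bidisc : Set (ℂ × ℂ) := Metric.ball 0 1 ×ˢ Metric.ball 0 1

/-- The closed unit disc; a finite measure on it is an element of `M_+` of the closed disc. -/
abbrev ClosedDisc : Type := Metric.closedBall (0 : ℂ) 1

open Classical in
/-- Extension by zero of a function on the bidisc; only its values and derivatives at
points of the (open) bidisc are used below. -/
def zeroExt (f : bidisc → ℂ) (z : ℂ × ℂ) : ℂ := if h : z ∈ bidisc then f ⟨z, h⟩ else 0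

/-- `f` is holomorphic on the bidisc. -/
def IsHolo (f : bidisc → ℂ) : Prop := DifferentiableOn ℂ (zeroExt f) bidisc

/-- `∂₁ f (z)` -/
def partial₁ (f : bidisc → ℂ) (z : ℂ × ℂ) : ℂ := fderiv ℂ (zeroExt f) z (1, 0)

/-- `∂₂ f (z)` -/
def partial₂ (f : bidisc → ℂ) (z : ℂ × ℂ) : ℂ := fderiv ℂ (zeroExt f) z (0, 1)

/-- The mean `∫₀^{2π} g(θ) dθ / 2π`. -/
def circleMean (g : ℝ → ℝ≥0∞) : ℝ≥0∞ :=
  (ENNReal.ofReal (2 * Real.pi))⁻¹ * ∫⁻ θ in Set.Icc 0 (2 * Real.pi), g θ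

/-- The square of the norm of the Hardy space `H²` of the bidisc (with value `∞` off `H²`). -/
def hardySq (f : bidisc → ℂ) : ℝ≥0∞ :=
  ⨆ r ∈ Set.Ioo (0 : ℝ) 1, circleMean fun s => circleMean fun t =>
    ‖zeroExt f (circleMap 0 r s, circleMap 0 r t)‖ₑ ^ 2

/-- Normalized area measure on the open unit disc. -/
def discArea : Measure ℂ := (ENNReal.ofReal Real.pi)⁻¹ • volume.restrict (Metric.ball 0 1)

open Classical in
/-- The kernel `log |(1 - ζ̄ w) / (w - ζ)|² / (1 - |ζ|²)`, for `ζ`, `w` in the open unit disc,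
with value `∞` at `w = ζ`. -/
def greenKernel (ζ w : ℂ) : ℝ≥0∞ :=
  if w = ζ then ⊤ else ENNReal.ofReal
    (Real.log (‖(1 - (starRingEnd ℂ) ζ * w) / (w - ζ)‖ ^ 2) / (1 - ‖ζ‖ ^ 2))

/-- The Poisson kernel `(1 - |w|²) / |ζ - w|²`, for `|ζ| = 1`, `|w| < 1`. -/
def poissonKer (ζ w : ℂ) : ℝ≥0∞ := ENNReal.ofReal ((1 - ‖w‖ ^ 2) / ‖ζ - w‖ ^ 2)

/-- The superharmonic weight `U_μ` on the open unit disc. -/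
def weight (μ : Measure ClosedDisc) (w : ℂ) : ℝ≥0∞ :=
  (∫⁻ ζ in {ζ : ClosedDisc | ‖(ζ : ℂ)‖ < 1}, greenKernel ζ w ∂μ) +
    ∫⁻ ζ in {ζ : ClosedDisc | ‖(ζ : ℂ)‖ = 1}, poissonKer ζ w ∂μ

/-- First summand of the Dirichlet integral. -/
def dirichlet₁ (μ : Measure ClosedDisc) (f : bidisc → ℂ) : ℝ≥0∞ :=
  ⨆ r ∈ Set.Ioo (0 : ℝ) 1, circleMean fun θ =>
    ∫⁻ z, ‖partial₁ f (z, circleMap 0 r θ)‖ₑ ^ 2 * weight μ z ∂discArea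

/-- Second summand of the Dirichlet integral. -/
def dirichlet₂ (μ : Measure ClosedDisc) (f : bidisc → ℂ) : ℝ≥0∞ :=
  ⨆ r ∈ Set.Ioo (0 : ℝ) 1, circleMean fun θ =>
    ∫⁻ z, ‖partial₂ f (circleMap 0 r θ, z)‖ₑ ^ 2 * weight μ z ∂discArea

/-- The Dirichlet integral `D_{μ₁,μ₂}(f)`. -/
def dirichletIntegral (μ₁ μ₂ : Measure ClosedDisc) (f : bidisc → ℂ) : ℝ≥0∞ :=
  dirichlet₁ μ₁ f + dirichlet₂ μ₂ f

/-- The square of the norm of the Dirichlet-type space. -/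
def normSq (μ₁ μ₂ : Measure ClosedDisc) (f : bidisc → ℂ) : ℝ≥0∞ :=
  hardySq f + dirichletIntegral μ₁ μ₂ f

/-! Facts needed for the vector space structure and the norm. -/

theorem isOpen_bidisc : IsOpen bidisc := Metric.isOpen_ball.prod Metric.isOpen_ball

theorem zeroExt_apply (f : bidisc → ℂ) (z : bidisc) : zeroExt f z = f z := by
  simp [zeroExt]

theorem zeroExt_add (f g : bidisc → ℂ) : zeroExt (f + g) = zeroExt f + zeroExt g := by
  ext z; by_cases h : z ∈ bidisc <;> simp [zeroExt, h]

theorem zeroExt_smul (c : ℂ) (f : bidisc → ℂ) : zeroExt (c • f) = c • zeroExt f := by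
  ext z; by_cases h : z ∈ bidisc <;> simp [zeroExt, h]

theorem zeroExt_zero : zeroExt 0 = 0 := by
  ext z; simp [zeroExt]

theorem IsHolo.add {f g : bidisc → ℂ} (hf : IsHolo f) (hg : IsHolo g) : IsHolo (f + g) := by
  unfold IsHolo; rw [zeroExt_add]; exact DifferentiableOn.add hf hg

theorem IsHolo.smul (c : ℂ) {f : bidisc → ℂ} (hf : IsHolo f) : IsHolo (c • f) := by
  unfold IsHolo; rw [zeroExt_smul]; exact DifferentiableOn.const_smul hf c

theorem IsHolo.differentiableAt {f : bidisc → ℂ} (hf : IsHolo f) {z : ℂ × ℂ}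
    (hz : z ∈ bidisc) : DifferentiableAt ℂ (zeroExt f) z :=
  DifferentiableOn.differentiableAt hf (isOpen_bidisc.mem_nhds hz)

theorem circle_mem {r : ℝ} (hr : r ∈ Set.Ioo (0 : ℝ) 1) (θ : ℝ) :
    circleMap 0 r θ ∈ Metric.ball (0 : ℂ) 1 := by
  simp [abs_of_pos hr.1, hr.2]

theorem measurable_partial₁ (f : bidisc → ℂ) : Measurable (partial₁ f) :=
  measurable_fderiv_apply_const ℂ _ _

theorem measurable_partial₂ (f : bidisc → ℂ) : Measurable (partial₂ f) :=
  measurable_fderiv_apply_const ℂ _ _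

theorem measurable_weight (μ : Measure ClosedDisc) [IsFiniteMeasure μ] :
    Measurable (weight μ) := by
  have h1 : Measurable fun p : ℂ × ClosedDisc => greenKernel p.2 p.1 := by
    unfold greenKernel
    refine Measurable.ite (measurableSet_eq_fun (by fun_prop) (by fun_prop)) (by fun_prop) ?_
    have hc : Measurable (starRingEnd ℂ) := Complex.continuous_conj.measurable
    fun_prop
  have h2 : Measurable fun p : ℂ × ClosedDisc => poissonKer p.2 p.1 := by
    unfold poissonKer
    fun_prop
  exact (Measurable.lintegral_prod_right h1).add (Measurable.lintegral_prod_right h2)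

theorem circleMean_mono {g h : ℝ → ℝ≥0∞} (H : ∀ θ, g θ ≤ h θ) :
    circleMean g ≤ circleMean h := by
  unfold circleMean; gcongr; exact H _

theorem circleMean_const_mul {c : ℝ≥0∞} (hc : c ≠ ⊤) (g : ℝ → ℝ≥0∞) :
    circleMean (fun θ => c * g θ) = c * circleMean g := by
  unfold circleMean; rw [lintegral_const_mul' _ _ hc]; ring

theorem circleMean_add {g h : ℝ → ℝ≥0∞} (hg : Measurable g) :
    circleMean (fun θ => g θ + h θ) = circleMean g + circleMean h := by
  unfold circleMean; rw [lintegral_add_left hg]; ring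

theorem measurable_circleMean {g : ℝ → ℝ → ℝ≥0∞} (hg : Measurable (Function.uncurry g)) :
    Measurable fun s => circleMean (g s) := by
  unfold circleMean
  exact (Measurable.lintegral_prod_right' hg).const_mul _

/-- Constants with `|a + b|² ≤ c |a|² + d |b|²`. -/
structure QuadConst (c d : ℝ≥0∞) : Prop where
  hc : c ≠ ⊤
  hd : d ≠ ⊤
  le : ∀ a b : ℂ, ‖a + b‖ₑ ^ 2 ≤ c * ‖a‖ₑ ^ 2 + d * ‖b‖ₑ ^ 2

theorem quadConst_of_pos {t : ℝ} (ht : 0 < t) :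
    QuadConst (ENNReal.ofReal (1 + t)) (ENNReal.ofReal (1 + t⁻¹)) := by
  refine ⟨ENNReal.ofReal_ne_top, ENNReal.ofReal_ne_top, fun a b => ?_⟩
  simp only [← ofReal_norm]
  rw [← ENNReal.ofReal_pow (norm_nonneg _), ← ENNReal.ofReal_pow (norm_nonneg _),
    ← ENNReal.ofReal_pow (norm_nonneg _), ← ENNReal.ofReal_mul (by positivity),
    ← ENNReal.ofReal_mul (by positivity), ← ENNReal.ofReal_add (by positivity) (by positivity)]
  apply ENNReal.ofReal_le_ofReal
  have h1 : ‖a + b‖ ^ 2 ≤ (‖a‖ + ‖b‖) ^ 2 := by gcongr; exact norm_add_le _ _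
  have h2 : (1 + t) * ‖a‖ ^ 2 + (1 + t⁻¹) * ‖b‖ ^ 2 - (‖a‖ + ‖b‖) ^ 2
      = t⁻¹ * (t * ‖a‖ - ‖b‖) ^ 2 := by
    field_simp; ring
  have h3 : 0 ≤ t⁻¹ * (t * ‖a‖ - ‖b‖) ^ 2 := by positivity
  linarith

theorem measurable_torus {f : bidisc → ℂ} (hf : IsHolo f) {r : ℝ} (hr : r ∈ Set.Ioo (0 : ℝ) 1) :
    Continuous fun p : ℝ × ℝ => zeroExt f (circleMap 0 r p.1, circleMap 0 r p.2) := by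
  refine ContinuousOn.comp_continuous (s := bidisc) hf.continuousOn (by fun_prop) ?_
  exact fun p => ⟨circle_mem hr _, circle_mem hr _⟩

theorem hardySq_add_le {c d : ℝ≥0∞} (h : QuadConst c d) {f g : bidisc → ℂ} (hf : IsHolo f) :
    hardySq (f + g) ≤ c * hardySq f + d * hardySq g := by
  refine iSup₂_le fun r hr => ?_
  have hm : Measurable (Function.uncurry fun s t =>
      c * ‖zeroExt f (circleMap 0 r s, circleMap 0 r t)‖ₑ ^ 2) :=
    ((measurable_torus hf hr).measurable.enorm.pow_const 2).const_mul c
  have key : (circleMean fun s => circleMean fun t =>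
      ‖zeroExt (f + g) (circleMap 0 r s, circleMap 0 r t)‖ₑ ^ 2) ≤
      c * (circleMean fun s => circleMean fun t =>
        ‖zeroExt f (circleMap 0 r s, circleMap 0 r t)‖ₑ ^ 2) +
      d * (circleMean fun s => circleMean fun t =>
        ‖zeroExt g (circleMap 0 r s, circleMap 0 r t)‖ₑ ^ 2) := by
    rw [← circleMean_const_mul h.hc, ← circleMean_const_mul h.hd]
    simp only [← circleMean_const_mul h.hc, ← circleMean_const_mul h.hd]
    rw [← circleMean_add (measurable_circleMean hm)]
    refine circleMean_mono fun s => ?_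
    have hms := hm.of_uncurry_left (x := s)
    rw [← circleMean_add hms]
    refine circleMean_mono fun t => ?_
    rw [zeroExt_add]
    exact h.le _ _
  refine key.trans ?_
  gcongr
  · exact le_iSup₂_of_le r hr le_rfl
  · exact le_iSup₂_of_le r hr le_rfl

theorem ae_discArea {p : ℂ → Prop} (h : ∀ z ∈ Metric.ball (0 : ℂ) 1, p z) :
    ∀ᵐ z ∂discArea, p z :=
  Measure.ae_smul_measure (ae_restrict_of_forall_mem measurableSet_ball h) _

instance : SFinite discArea := by unfold discArea; infer_instance

/-- Common part of the estimates for the two summands of the Dirichlet integral. -/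
theorem mean_add_le {c d : ℝ≥0∞} (h : QuadConst c d) {W : ℂ → ℝ≥0∞} (hW : Measurable W)
    {F G H : ℝ → ℂ → ℂ} (hF : Measurable (Function.uncurry F))
    (hH : ∀ θ, ∀ z ∈ Metric.ball (0 : ℂ) 1, H θ z = F θ z + G θ z) :
    (circleMean fun θ => ∫⁻ z, ‖H θ z‖ₑ ^ 2 * W z ∂discArea) ≤
      c * (circleMean fun θ => ∫⁻ z, ‖F θ z‖ₑ ^ 2 * W z ∂discArea) +
      d * (circleMean fun θ => ∫⁻ z, ‖G θ z‖ₑ ^ 2 * W z ∂discArea) := by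
  have hm : Measurable (Function.uncurry fun θ z => c * (‖F θ z‖ₑ ^ 2 * W z)) :=
    ((hF.enorm.pow_const 2).mul (hW.comp measurable_snd)).const_mul c
  rw [← circleMean_const_mul h.hc, ← circleMean_const_mul h.hd]
  simp only [← lintegral_const_mul' _ _ h.hc, ← lintegral_const_mul' _ _ h.hd]
  have hm' : Measurable fun θ => ∫⁻ z, c * (‖F θ z‖ₑ ^ 2 * W z) ∂discArea :=
    Measurable.lintegral_prod_right hm
  rw [← circleMean_add hm']
  refine circleMean_mono fun θ => ?_
  have hms := hm.of_uncurry_left (x := θ)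
  rw [← lintegral_add_left hms]
  refine lintegral_mono_ae (ae_discArea fun z hz => ?_)
  rw [hH θ z hz, ← mul_assoc, ← mul_assoc, ← add_mul]
  gcongr
  exact h.le _ _

theorem dirichlet₁_add_le {c d : ℝ≥0∞} (h : QuadConst c d) (μ : Measure ClosedDisc)
    [IsFiniteMeasure μ] {f g : bidisc → ℂ} (hf : IsHolo f) (hg : IsHolo g) :
    dirichlet₁ μ (f + g) ≤ c * dirichlet₁ μ f + d * dirichlet₁ μ g := by
  refine iSup₂_le fun r hr => ?_
  refine (mean_add_le h (measurable_weight μ)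
    (F := fun θ z => partial₁ f (z, circleMap 0 r θ))
    (G := fun θ z => partial₁ g (z, circleMap 0 r θ)) ?_ ?_).trans ?_
  · exact (measurable_partial₁ f).comp (by fun_prop :
      Measurable fun p : ℝ × ℂ => (p.2, circleMap 0 r p.1))
  · intro θ z hz
    have hm : (z, circleMap 0 r θ) ∈ bidisc := ⟨hz, circle_mem hr θ⟩
    simp only [partial₁]
    rw [zeroExt_add, fderiv_add (hf.differentiableAt hm) (hg.differentiableAt hm)]
    rfl
  · gcongr
    · exact le_iSup₂_of_le r hr le_rfl
    · exact le_iSup₂_of_le r hr le_rfl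

theorem dirichlet₂_add_le {c d : ℝ≥0∞} (h : QuadConst c d) (μ : Measure ClosedDisc)
    [IsFiniteMeasure μ] {f g : bidisc → ℂ} (hf : IsHolo f) (hg : IsHolo g) :
    dirichlet₂ μ (f + g) ≤ c * dirichlet₂ μ f + d * dirichlet₂ μ g := by
  refine iSup₂_le fun r hr => ?_
  refine (mean_add_le h (measurable_weight μ)
    (F := fun θ z => partial₂ f (circleMap 0 r θ, z))
    (G := fun θ z => partial₂ g (circleMap 0 r θ, z)) ?_ ?_).trans ?_
  · exact (measurable_partial₂ f).comp (by fun_prop :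
      Measurable fun p : ℝ × ℂ => (circleMap 0 r p.1, p.2))
  · intro θ z hz
    have hm : (circleMap 0 r θ, z) ∈ bidisc := ⟨circle_mem hr θ, hz⟩
    simp only [partial₂]
    rw [zeroExt_add, fderiv_add (hf.differentiableAt hm) (hg.differentiableAt hm)]
    rfl
  · gcongr
    · exact le_iSup₂_of_le r hr le_rfl
    · exact le_iSup₂_of_le r hr le_rfl

theorem normSq_add_le {c d : ℝ≥0∞} (h : QuadConst c d) (μ₁ μ₂ : Measure ClosedDisc)
    [IsFiniteMeasure μ₁] [IsFiniteMeasure μ₂] {f g : bidisc → ℂ} (hf : IsHolo f)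
    (hg : IsHolo g) :
    normSq μ₁ μ₂ (f + g) ≤ c * normSq μ₁ μ₂ f + d * normSq μ₁ μ₂ g := by
  unfold normSq dirichletIntegral
  refine (add_le_add (hardySq_add_le h hf) (add_le_add (dirichlet₁_add_le h μ₁ hf hg)
    (dirichlet₂_add_le h μ₂ hf hg))).trans (le_of_eq ?_)
  ring

theorem partial₁_smul (a : ℂ) (f : bidisc → ℂ) (z : ℂ × ℂ) :
    partial₁ (a • f) z = a * partial₁ f z := by
  simp only [partial₁]
  rw [zeroExt_smul, fderiv_const_smul_field]
  rfl

theorem partial₂_smul (a : ℂ) (f : bidisc → ℂ) (z : ℂ × ℂ) :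
    partial₂ (a • f) z = a * partial₂ f z := by
  simp only [partial₂]
  rw [zeroExt_smul, fderiv_const_smul_field]
  rfl

theorem normSq_smul (μ₁ μ₂ : Measure ClosedDisc) (a : ℂ) (f : bidisc → ℂ) :
    normSq μ₁ μ₂ (a • f) = ‖a‖ₑ ^ 2 * normSq μ₁ μ₂ f := by
  have ha : ‖a‖ₑ ^ 2 ≠ ⊤ := by simp
  have e1 : hardySq (a • f) = ‖a‖ₑ ^ 2 * hardySq f := by
    unfold hardySq
    simp only [ENNReal.mul_iSup, ← circleMean_const_mul ha, zeroExt_smul, Pi.smul_apply,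
      smul_eq_mul, enorm_mul, mul_pow]
  have e2 : dirichlet₁ μ₁ (a • f) = ‖a‖ₑ ^ 2 * dirichlet₁ μ₁ f := by
    unfold dirichlet₁
    simp only [ENNReal.mul_iSup, ← circleMean_const_mul ha, ← lintegral_const_mul' _ _ ha,
      partial₁_smul, enorm_mul, mul_pow, mul_assoc]
  have e3 : dirichlet₂ μ₂ (a • f) = ‖a‖ₑ ^ 2 * dirichlet₂ μ₂ f := by
    unfold dirichlet₂
    simp only [ENNReal.mul_iSup, ← circleMean_const_mul ha, ← lintegral_const_mul' _ _ ha,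
      partial₂_smul, enorm_mul, mul_pow, mul_assoc]
  unfold normSq dirichletIntegral
  rw [e1, e2, e3]; ring

theorem eq_zero_of_circleMean {g : ℝ → ℝ≥0∞} (hg : Measurable g) (h : circleMean g = 0) :
    ∀ᵐ θ ∂volume.restrict (Set.Icc 0 (2 * Real.pi)), g θ = 0 := by
  unfold circleMean at h
  rcases mul_eq_zero.1 h with h | h
  · exact absurd (ENNReal.inv_eq_zero.1 h) ENNReal.ofReal_ne_top
  · exact (lintegral_eq_zero_iff hg).1 h

theorem eq_zero_of_ae_circle {u : ℂ → ℂ} {r : ℝ} (hr : r ∈ Set.Ioo (0 : ℝ) 1)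
    (hu : ContinuousOn u (Metric.ball 0 1))
    (h : ∀ᵐ θ ∂volume.restrict (Set.Icc 0 (2 * Real.pi)), u (circleMap 0 r θ) = 0) :
    ∀ z ∈ Metric.sphere (0 : ℂ) r, u z = 0 := by
  have h1 : Set.EqOn (fun θ => u (circleMap 0 r θ)) (fun _ => 0) (Set.Icc 0 (2 * Real.pi)) :=
    Measure.eqOn_Icc_of_ae_eq volume (by positivity) h
      (hu.comp_continuous (by fun_prop) (circle_mem hr)).continuousOn continuousOn_const
  intro z hz
  rw [← abs_of_pos hr.1, ← image_circleMap_Ioc] at hz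
  obtain ⟨θ, hθ, rfl⟩ := hz
  exact h1 ⟨hθ.1.le, hθ.2⟩

theorem eq_zero_of_sphere {u : ℂ → ℂ} {r : ℝ} (hr : r ∈ Set.Ioo (0 : ℝ) 1)
    (hu : DifferentiableOn ℂ u (Metric.ball 0 1))
    (h : ∀ z ∈ Metric.sphere (0 : ℂ) r, u z = 0) :
    ∀ z ∈ Metric.closedBall (0 : ℂ) r, u z = 0 := by
  have hd : DiffContOnCl ℂ u (Metric.ball 0 r) :=
    (hu.mono (Metric.closedBall_subset_ball hr.2)).diffContOnCl_ball le_rfl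
  intro z hz
  rw [← closure_ball 0 hr.1.ne'] at hz
  refine Complex.eqOn_closure_of_eqOn_frontier (g := fun _ => 0) Metric.isBounded_ball hd
    diffContOnCl_const (fun w hw => ?_) hz
  rw [frontier_ball 0 hr.1.ne'] at hw
  exact h w hw

theorem eq_zero_of_hardySq {f : bidisc → ℂ} (hf : IsHolo f) (h : hardySq f = 0) : f = 0 := by
  have hS : ∀ w ∈ Metric.ball (0 : ℂ) 1,
      DifferentiableOn ℂ (fun z => zeroExt f (z, w)) (Metric.ball 0 1) ∧
      DifferentiableOn ℂ (fun z => zeroExt f (w, z)) (Metric.ball 0 1) := by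
    intro w hw
    constructor
    · exact DifferentiableOn.comp (t := bidisc) hf (by fun_prop) (fun z hz => ⟨hz, hw⟩)
    · exact DifferentiableOn.comp (t := bidisc) hf (by fun_prop) (fun z hz => ⟨hw, hz⟩)
  have main : ∀ r ∈ Set.Ioo (0 : ℝ) 1, ∀ z ∈ Metric.closedBall (0 : ℂ) r,
      ∀ w ∈ Metric.closedBall (0 : ℂ) r, zeroExt f (z, w) = 0 := by
    intro r hr
    have hc := measurable_torus hf hr
    have h0 : (circleMean fun s => circleMean fun t =>
        ‖zeroExt f (circleMap 0 r s, circleMap 0 r t)‖ₑ ^ 2) = 0 := by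
      refine le_antisymm ?_ bot_le
      rw [← h]
      exact le_iSup₂_of_le r hr le_rfl
    have hm : Measurable (Function.uncurry fun s t =>
        ‖zeroExt f (circleMap 0 r s, circleMap 0 r t)‖ₑ ^ 2) :=
      hc.measurable.enorm.pow_const 2
    have hmc := measurable_circleMean hm
    have h1 := eq_zero_of_circleMean hmc h0
    have h2 : ∀ᵐ s ∂volume.restrict (Set.Icc 0 (2 * Real.pi)),
        ∀ w ∈ Metric.sphere (0 : ℂ) r, zeroExt f (circleMap 0 r s, w) = 0 := by
      filter_upwards [h1] with s hs
      have hms := hm.of_uncurry_left (x := s)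
      have h3 := eq_zero_of_circleMean hms hs
      refine eq_zero_of_ae_circle (u := fun w => zeroExt f (circleMap 0 r s, w)) hr
        (hS _ (circle_mem hr s)).2.continuousOn ?_
      filter_upwards [h3] with t ht
      simpa using ht
    have hsub : Metric.closedBall (0 : ℂ) r ⊆ Metric.ball 0 1 :=
      Metric.closedBall_subset_ball hr.2
    have h4 : ∀ w ∈ Metric.sphere (0 : ℂ) r, ∀ z ∈ Metric.closedBall (0 : ℂ) r,
        zeroExt f (z, w) = 0 := by
      intro w hw
      have hw1 : w ∈ Metric.ball (0 : ℂ) 1 := hsub (Metric.sphere_subset_closedBall hw)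
      refine eq_zero_of_sphere (u := fun z => zeroExt f (z, w)) hr (hS w hw1).1 ?_
      refine eq_zero_of_ae_circle (u := fun z => zeroExt f (z, w)) hr
        (hS w hw1).1.continuousOn ?_
      filter_upwards [h2] with s hs using hs w hw
    intro z hz
    exact eq_zero_of_sphere (u := fun w => zeroExt f (z, w)) hr (hS z (hsub hz)).2
      (fun w hw => h4 w hw z hz)
  funext z
  obtain ⟨⟨z, w⟩, hzw⟩ := z
  obtain ⟨hz, hw⟩ := id hzw
  have hz' : ‖z‖ < 1 := by simpa using hz
  have hw' : ‖w‖ < 1 := by simpa using hw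
  obtain ⟨r, hr1, hr2⟩ := exists_between (max_lt hz' hw')
  have := main r ⟨(norm_nonneg z).trans_lt ((le_max_left _ _).trans_lt hr1), hr2⟩ z
    (by simpa using ((le_max_left _ _).trans hr1.le)) w
    (by simpa using ((le_max_right _ _).trans hr1.le))
  exact (zeroExt_apply f ⟨(z, w), hzw⟩).symm.trans this

/-- The holomorphic functions `f` in `H²` of the bidisc with finite Dirichlet integral,
as a space of functions on the bidisc. -/
def dirichletSubmodule (μ₁ μ₂ : Measure ClosedDisc) [IsFiniteMeasure μ₁]
    [IsFiniteMeasure μ₂] : Submodule ℂ (bidisc → ℂ) where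
  carrier := {f | IsHolo f ∧ hardySq f < ⊤ ∧ dirichletIntegral μ₁ μ₂ f < ⊤}
  zero_mem' := by
    have h0 : normSq μ₁ μ₂ 0 = 0 := by
      have := normSq_smul μ₁ μ₂ 0 0
      simpa using this
    have hz := add_eq_zero.1 h0
    refine ⟨?_, ?_, ?_⟩
    · unfold IsHolo; rw [zeroExt_zero]; exact differentiableOn_const 0
    · rw [hz.1]; exact ENNReal.zero_lt_top
    · rw [hz.2]; exact ENNReal.zero_lt_top
  add_mem' := by
    rintro f g ⟨hf, hf1, hf2⟩ ⟨hg, hg1, hg2⟩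
    have hq := quadConst_of_pos one_pos
    have h := normSq_add_le hq μ₁ μ₂ hf hg
    have hlt : normSq μ₁ μ₂ (f + g) < ⊤ := h.trans_lt (ENNReal.add_lt_top.2
      ⟨ENNReal.mul_lt_top hq.hc.lt_top (ENNReal.add_lt_top.2 ⟨hf1, hf2⟩),
        ENNReal.mul_lt_top hq.hd.lt_top (ENNReal.add_lt_top.2 ⟨hg1, hg2⟩)⟩)
    exact ⟨hf.add hg, ENNReal.add_lt_top.1 hlt⟩
  smul_mem' := by
    rintro a f ⟨hf, hf1, hf2⟩
    have hlt : normSq μ₁ μ₂ (a • f) < ⊤ := by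
      rw [normSq_smul]
      exact ENNReal.mul_lt_top (by simp) (ENNReal.add_lt_top.2 ⟨hf1, hf2⟩)
    exact ⟨hf.smul a, ENNReal.add_lt_top.1 hlt⟩

/-- The Dirichlet-type space `D(μ₁, μ₂)`. It is a separate type so that its topology is the one
of its norm, not that of pointwise convergence. -/
def DirichletSpace (μ₁ μ₂ : Measure ClosedDisc) [IsFiniteMeasure μ₁] [IsFiniteMeasure μ₂] :
    Type := dirichletSubmodule μ₁ μ₂

variable (μ₁ μ₂ : Measure ClosedDisc) [IsFiniteMeasure μ₁] [IsFiniteMeasure μ₂]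

instance : AddCommGroup (DirichletSpace μ₁ μ₂) :=
  inferInstanceAs (AddCommGroup (dirichletSubmodule μ₁ μ₂))

instance : Module ℂ (DirichletSpace μ₁ μ₂) :=
  inferInstanceAs (Module ℂ (dirichletSubmodule μ₁ μ₂))

/-- Elements of the space are functions on the bidisc. -/
instance : CoeFun (DirichletSpace μ₁ μ₂) fun _ => bidisc → ℂ := ⟨fun f => f.1⟩

/-- `‖f‖² = ‖f‖²_{H²} + D_{μ₁,μ₂}(f)` -/
instance : Norm (DirichletSpace μ₁ μ₂) :=
  ⟨fun f => Real.sqrt (hardySq f + dirichletIntegral μ₁ μ₂ f).toReal⟩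

theorem norm_core : NormedSpace.Core ℂ (DirichletSpace μ₁ μ₂) where
  norm_nonneg f := Real.sqrt_nonneg _
  norm_smul a f := by
    change Real.sqrt (normSq μ₁ μ₂ (a • f.1)).toReal = ‖a‖ * Real.sqrt (normSq μ₁ μ₂ f.1).toReal
    rw [normSq_smul, ENNReal.toReal_mul, ENNReal.toReal_pow, toReal_enorm,
      Real.sqrt_mul (by positivity), Real.sqrt_sq (norm_nonneg a)]
  norm_triangle f g := by
    change Real.sqrt (normSq μ₁ μ₂ (f.1 + g.1)).toReal ≤
      Real.sqrt (normSq μ₁ μ₂ f.1).toReal + Real.sqrt (normSq μ₁ μ₂ g.1).toReal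
    have hF : normSq μ₁ μ₂ f.1 ≠ ⊤ := (ENNReal.add_lt_top.2 f.2.2).ne
    have hG : normSq μ₁ μ₂ g.1 ≠ ⊤ := (ENNReal.add_lt_top.2 g.2.2).ne
    set A := (normSq μ₁ μ₂ f.1).toReal
    set B := (normSq μ₁ μ₂ g.1).toReal
    have hA : Real.sqrt A ^ 2 = A := Real.sq_sqrt ENNReal.toReal_nonneg
    have hB : Real.sqrt B ^ 2 = B := Real.sq_sqrt ENNReal.toReal_nonneg
    have ha := Real.sqrt_nonneg A
    have hb := Real.sqrt_nonneg B
    set a := Real.sqrt A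
    set b := Real.sqrt B
    refine le_of_forall_pos_le_add fun ε hε => ?_
    have hx : 0 < a + ε / 2 := by positivity
    have hy : 0 < b + ε / 2 := by positivity
    set t : ℝ := (b + ε / 2) / (a + ε / 2) with ht
    have htp : 0 < t := by positivity
    have hq := quadConst_of_pos htp
    have h := normSq_add_le hq μ₁ μ₂ f.2.1 g.2.1
    have h' : (normSq μ₁ μ₂ (f.1 + g.1)).toReal ≤ (1 + t) * A + (1 + t⁻¹) * B := by
      refine (ENNReal.toReal_mono (ENNReal.add_ne_top.2 ⟨ENNReal.mul_ne_top hq.hc hF,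
        ENNReal.mul_ne_top hq.hd hG⟩) h).trans (le_of_eq ?_)
      rw [ENNReal.toReal_add (ENNReal.mul_ne_top hq.hc hF) (ENNReal.mul_ne_top hq.hd hG),
        ENNReal.toReal_mul, ENNReal.toReal_mul, ENNReal.toReal_ofReal (by positivity),
        ENNReal.toReal_ofReal (by positivity)]
    apply Real.sqrt_le_iff.2
    refine ⟨by positivity, h'.trans ?_⟩
    have e : (1 + t) * (a + ε / 2) ^ 2 + (1 + t⁻¹) * (b + ε / 2) ^ 2 = (a + b + ε) ^ 2 := by
      rw [ht]; field_simp; ring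
    rw [← e, ← hA, ← hB]
    gcongr <;> linarith
  norm_eq_zero_iff f := by
    constructor
    · intro h
      have h1 : (normSq μ₁ μ₂ f.1).toReal = 0 :=
        (Real.sqrt_eq_zero ENNReal.toReal_nonneg).1 h
      have h2 : normSq μ₁ μ₂ f.1 = 0 := by
        rcases (ENNReal.toReal_eq_zero_iff _).1 h1 with h2 | h2
        · exact h2
        · exact absurd h2 (ENNReal.add_lt_top.2 f.2.2).ne
      exact Subtype.ext (eq_zero_of_hardySq f.2.1 (add_eq_zero.1 h2).1)
    · rintro rfl
      change Real.sqrt (normSq μ₁ μ₂ 0).toReal = 0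
      have := normSq_smul μ₁ μ₂ 0 0
      rw [show normSq μ₁ μ₂ 0 = 0 by simpa using this]
      simp

instance : NormedAddCommGroup (DirichletSpace μ₁ μ₂) :=
  NormedAddCommGroup.ofCore (norm_core μ₁ μ₂)

instance : NormedSpace ℂ (DirichletSpace μ₁ μ₂) :=
  NormedSpace.ofCore (norm_core μ₁ μ₂)

end BidiscDirichlet

end

open MeasureTheory
open scoped ENNReal

namespace BidiscDirichlet

/-! Since `∂₁(z₁ f) = f + z₁ ∂₁ f`, `∂₂(z₁ f) = z₁ ∂₂ f` and `|z₁| < 1`, the only term not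
controlled at once by the norm of `f` is the mean over `θ` of `∫ |f(z, re^{iθ})|² U_μ(z) dA(z)`. It
must be bounded by a multiple of `‖f‖²` in `H²`; this is `exists_mean_weight_le`. The second
coordinate follows by exchanging the variables.

In one variable the claim is that `U_μ dA` is a Carleson measure for the Hardy space of the disc.
Both kernels in `U_μ` are at most `4 / |w - ζ|` (`weight_le`), so by Tonelli it is enough to treat
`dA / |z - ζ|` with a constant independent of `ζ` (`exists_carleson_le`).

Point evaluations on a disc of radius `ρ < 1` are inner products with Szegő kernel vectors. A `TT*`
argument (`lintegral_inner_sq_le`) turns the embedding into a bound for the quadratic form of the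
Szegő kernel, whose modulus is at most `1 / |z - w|`. Schur's test (`lintegral_schur_le`) with test
function `|z - ζ|^{-1/2}` gives that bound. Its hypothesis is the planar estimate `∫ |z - w|⁻¹ |z -
ζ|^{-3/2} dA(z) ≤ C |w - ζ|^{-1/2}` (`exists_lintegral_riesz_le`), where scaling makes `C`
independent of both points. -/

/-! ### Domination of the weight by a Riesz potential. -/

theorem norm_sub_sq_add_eq (ζ w : ℂ) :
    ‖1 - (starRingEnd ℂ) ζ * w‖ ^ 2 = ‖w - ζ‖ ^ 2 + (1 - ‖ζ‖ ^ 2) * (1 - ‖w‖ ^ 2) := by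
  simp only [Complex.sq_norm, Complex.normSq_apply]
  simp
  ring

theorem one_sub_norm_le (ζ w : ℂ) (hζ : ‖ζ‖ ≤ 1) :
    1 - ‖w‖ ≤ ‖1 - (starRingEnd ℂ) ζ * w‖ := by
  have h1 : ‖(1 : ℂ)‖ - ‖(starRingEnd ℂ) ζ * w‖ ≤ ‖1 - (starRingEnd ℂ) ζ * w‖ :=
    norm_sub_norm_le _ _
  have h2 : ‖(starRingEnd ℂ) ζ * w‖ ≤ ‖w‖ := by
    rw [norm_mul, RCLike.norm_conj]
    exact mul_le_of_le_one_left (norm_nonneg _) hζ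
  rw [norm_one] at h1
  linarith

theorem ofReal_div_norm_le {a b : ℝ} {v : ℂ} (hv : v ≠ 0) (hb : 0 ≤ b) (h : a ≤ b / ‖v‖) :
    ENNReal.ofReal a ≤ ENNReal.ofReal b * ‖v‖ₑ⁻¹ := by
  rw [← ofReal_norm, ← ENNReal.ofReal_inv_of_pos (norm_pos_iff.2 hv), ← ENNReal.ofReal_mul hb]
  exact ENNReal.ofReal_le_ofReal h

/-- With `x = |1 - ζ̄w|` and `y = |w - ζ|`, the inequality `log t ≤ t - 1` gives `y log (x/y) ≤ x -
y`. Now `(x - y) x ≤ x² - y² = (1 - |ζ|²)(1 - |w|²)` and `1 - |w|² ≤ 2(1 - |w|) ≤ 2x`, so `x - y ≤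
2(1 - |ζ|²)`. The square inside the logarithm doubles 2 to 4. At `w = ζ` both sides are `⊤`. -/
theorem greenKernel_le {ζ w : ℂ} (hζ : ‖ζ‖ < 1) (hw : ‖w‖ < 1) :
    greenKernel ζ w ≤ ENNReal.ofReal 4 * ‖w - ζ‖ₑ⁻¹ := by
  unfold greenKernel
  split_ifs with h
  · simp [h]
  have hv : w - ζ ≠ 0 := sub_ne_zero.2 h
  refine ofReal_div_norm_le hv (by norm_num) ?_
  have hy : 0 < ‖w - ζ‖ := norm_pos_iff.2 hv
  have hz : 0 < 1 - ‖ζ‖ ^ 2 := by nlinarith [norm_nonneg ζ]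
  have hw2 : 0 < 1 - ‖w‖ ^ 2 := by nlinarith [norm_nonneg w]
  have e := norm_sub_sq_add_eq ζ w
  have hle := one_sub_norm_le ζ w hζ.le
  set x := ‖1 - (starRingEnd ℂ) ζ * w‖
  set y := ‖w - ζ‖
  have hx : 0 < x := lt_of_lt_of_le (by linarith) hle
  rw [norm_div, Real.log_pow, div_le_div_iff₀ hz hy]
  have hlog : Real.log (x / y) ≤ x / y - 1 := Real.log_le_sub_one_of_pos (by positivity)
  have h1 : Real.log (x / y) * y ≤ x - y := by
    calc Real.log (x / y) * y ≤ (x / y - 1) * y := by gcongr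
      _ = x - y := by field_simp
  have h3 : 1 - ‖w‖ ^ 2 ≤ 2 * x := by nlinarith [norm_nonneg w]
  have hxy : y ≤ x := by
    apply le_of_sq_le_sq _ hx.le
    rw [e]; nlinarith [mul_pos hz hw2]
  have h4 : (x - y) * x ≤ 2 * (1 - ‖ζ‖ ^ 2) * x := by
    calc (x - y) * x ≤ (x - y) * (x + y) := by gcongr; linarith
      _ = (1 - ‖ζ‖ ^ 2) * (1 - ‖w‖ ^ 2) := by linarith
      _ ≤ (1 - ‖ζ‖ ^ 2) * (2 * x) := by gcongr
      _ = _ := by ring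
  have h5 := le_of_mul_le_mul_right h4 hx
  push_cast
  linarith

/-- Here `1 - |w|² ≤ 2(1 - |w|) ≤ 2|w - ζ|`, so 2 would suffice; 4 matches the constant for the
Green kernel. -/
theorem poissonKer_le {ζ w : ℂ} (hζ : ‖ζ‖ = 1) (hw : ‖w‖ < 1) :
    poissonKer ζ w ≤ ENNReal.ofReal 4 * ‖w - ζ‖ₑ⁻¹ := by
  unfold poissonKer
  have hv : w - ζ ≠ 0 := by
    rintro h
    rw [sub_eq_zero.1 h] at hw
    exact hw.ne hζ
  refine ofReal_div_norm_le hv (by norm_num) ?_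
  have hy : 0 < ‖w - ζ‖ := norm_pos_iff.2 hv
  have h1 : ‖ζ‖ - ‖w‖ ≤ ‖w - ζ‖ := by rw [norm_sub_rev]; exact norm_sub_norm_le _ _
  rw [norm_sub_rev ζ w, div_le_div_iff₀ (by positivity) hy, sq ‖w - ζ‖, ← mul_assoc]
  gcongr
  nlinarith [norm_nonneg w]

theorem weight_le (μ : Measure ClosedDisc) {w : ℂ} (hw : ‖w‖ < 1) :
    weight μ w ≤ ENNReal.ofReal 4 * ∫⁻ ζ, ‖w - (ζ : ℂ)‖ₑ⁻¹ ∂μ := by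
  unfold weight
  have hc : Continuous fun ζ : ClosedDisc => ‖(ζ : ℂ)‖ := by fun_prop
  have m1 : MeasurableSet {ζ : ClosedDisc | ‖(ζ : ℂ)‖ < 1} :=
    measurableSet_lt hc.measurable measurable_const
  have m2 : MeasurableSet {ζ : ClosedDisc | ‖(ζ : ℂ)‖ = 1} :=
    measurableSet_eq_fun hc.measurable measurable_const
  rw [← lintegral_const_mul' _ _ ENNReal.ofReal_ne_top]
  calc _ ≤ (∫⁻ ζ in {ζ : ClosedDisc | ‖(ζ : ℂ)‖ < 1}, ENNReal.ofReal 4 * ‖w - (ζ : ℂ)‖ₑ⁻¹ ∂μ) +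
        ∫⁻ ζ in {ζ : ClosedDisc | ‖(ζ : ℂ)‖ = 1}, ENNReal.ofReal 4 * ‖w - (ζ : ℂ)‖ₑ⁻¹ ∂μ :=
        add_le_add (setLIntegral_mono' m1 fun ζ hζ => greenKernel_le hζ hw)
          (setLIntegral_mono' m2 fun ζ hζ => poissonKer_le hζ hw)
    _ = ∫⁻ ζ in {ζ : ClosedDisc | ‖(ζ : ℂ)‖ < 1} ∪ {ζ : ClosedDisc | ‖(ζ : ℂ)‖ = 1},
          ENNReal.ofReal 4 * ‖w - (ζ : ℂ)‖ₑ⁻¹ ∂μ := by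
        rw [lintegral_union m2]
        exact Set.disjoint_left.2 fun ζ h1 h2 => (ne_of_lt h1) h2
    _ ≤ _ := setLIntegral_le_lintegral _ _

/-! ### A Riesz potential estimate in the plane. -/

/-- The radial majorant `|u|^{-a} max(1, |u|)^{-b}`. -/
noncomputable def radial (a b x : ℝ) : ℝ := x ^ (-a) * (max 1 x) ^ (-b)

/-- In polar coordinates the integrand is `x^{1-a}` on `(0, 1]` and `x^{1-a-b}` beyond 1; the two
hypotheses give convergence at 0 and at infinity respectively. -/
theorem integrable_radial {a b : ℝ} (ha : a < 2) (hab : 2 < a + b) :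
    Integrable fun u : ℂ => radial a b ‖u‖ := by
  rw [integrable_fun_norm_addHaar (μ := volume) (f := radial a b), Complex.finrank_real_complex]
  have hm : Measurable (radial a b) := by unfold radial; fun_prop
  rw [← Set.Ioc_union_Ioi_eq_Ioi zero_le_one]
  refine IntegrableOn.union ?_ ?_
  · have h : IntegrableOn (fun x : ℝ => x ^ (1 - a)) (Set.Ioc 0 1) :=
      (intervalIntegral.intervalIntegrable_rpow' (by linarith)).1
    refine h.congr_fun (fun x hx => ?_) measurableSet_Ioc
    simp only [radial, max_eq_left hx.2, Real.one_rpow, mul_one, smul_eq_mul]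
    rw [Real.rpow_sub hx.1, Real.rpow_neg hx.1.le]
    norm_num
    rfl
  · have h : IntegrableOn (fun x : ℝ => x ^ (1 - a - b)) (Set.Ioi 1) :=
      integrableOn_Ioi_rpow_of_lt (by linarith) one_pos
    refine h.congr_fun (fun x hx => ?_) measurableSet_Ioi
    have hx0 : 0 < x := one_pos.trans hx
    simp only [radial, max_eq_right (Set.mem_Ioi.1 hx).le, smul_eq_mul]
    rw [Real.rpow_sub hx0, Real.rpow_sub hx0, Real.rpow_neg hx0.le, Real.rpow_neg hx0.le]
    norm_num
    ring

theorem lintegral_comp_div_sub (f : ℂ → ℝ≥0∞) (ζ : ℂ) {d : ℝ} (hd : 0 < d) :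
    ∫⁻ z, f ((d⁻¹ : ℝ) • (z - ζ)) = ENNReal.ofReal (d ^ 2) * ∫⁻ u, f u := by
  rw [lintegral_sub_right_eq_self (fun z => f ((d⁻¹ : ℝ) • z)) ζ]
  have h := Measure.map_addHaar_smul (volume : Measure ℂ) (inv_ne_zero hd.ne')
  have e := lintegral_map_equiv (μ := (volume : Measure ℂ)) f
    (Homeomorph.smulOfNeZero (d⁻¹ : ℝ) (inv_ne_zero hd.ne')).toMeasurableEquiv
  simp only [Homeomorph.toMeasurableEquiv_coe, Homeomorph.smulOfNeZero_apply] at e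
  rw [← e]
  change lintegral (Measure.map (fun x : ℂ => (d⁻¹ : ℝ) • x) volume) f = _
  rw [h, lintegral_smul_measure, Complex.finrank_real_complex]
  simp

/-- Substitute `z = ζ + d u`: the integrand contributes `d^{-a-b}` and area contributes `d²`. -/
theorem lintegral_radial_scale (a b : ℝ) (ζ : ℂ) {d : ℝ} (hd : 0 < d) :
    ∫⁻ z : ℂ, ENNReal.ofReal (‖z - ζ‖ ^ (-a) * (max d ‖z - ζ‖) ^ (-b)) =
      ENNReal.ofReal (d ^ (2 - a - b)) * ∫⁻ u : ℂ, ENNReal.ofReal (radial a b ‖u‖) := by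
  have h (z : ℂ) : ENNReal.ofReal (‖z - ζ‖ ^ (-a) * (max d ‖z - ζ‖) ^ (-b)) =
      ENNReal.ofReal (d ^ (- a - b)) *
        ENNReal.ofReal (radial a b ‖(d⁻¹ : ℝ) • (z - ζ)‖) := by
    rw [← ENNReal.ofReal_mul (by positivity)]
    congr 1
    unfold radial
    have e1 : ‖z - ζ‖ = d * ‖(d⁻¹ : ℝ) • (z - ζ)‖ := by
      rw [norm_smul, Real.norm_of_nonneg (by positivity)]; field_simp
    rw [e1]
    set x := ‖(d⁻¹ : ℝ) • (z - ζ)‖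
    have hx : 0 ≤ x := norm_nonneg _
    have e2 : max d (d * x) = d * max 1 x := by
      rw [mul_max_of_nonneg _ _ hd.le, mul_one]
    rw [e2, Real.mul_rpow hd.le hx, Real.mul_rpow hd.le (by positivity),
      show -a - b = -a + -b by ring, Real.rpow_add hd]
    ring
  simp only [h]
  rw [lintegral_const_mul' _ _ ENNReal.ofReal_ne_top,
    lintegral_comp_div_sub (fun u => ENNReal.ofReal (radial a b ‖u‖)) ζ hd, ← mul_assoc,
    ← ENNReal.ofReal_mul (by positivity)]
  congr 2
  rw [← Real.rpow_natCast d 2, ← Real.rpow_add hd]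
  congr 1
  push_cast
  ring

/-- The integrand is dominated by two radial majorants, one centred at each singularity, both of
total degree `-5/2`; scaling then leaves the power `2 - 5/2 = -1/2`. -/
theorem exists_lintegral_riesz_le : ∃ C : ℝ≥0∞, C ≠ ⊤ ∧ ∀ ζ w : ℂ, w ≠ ζ →
    ∫⁻ z : ℂ, ‖z - w‖ₑ⁻¹ * (‖z - ζ‖ₑ⁻¹ * ENNReal.ofReal (‖z - ζ‖ ^ (-(1 / 2) : ℝ))) ≤
      C * ENNReal.ofReal (‖w - ζ‖ ^ (-(1 / 2) : ℝ)) := by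
  set A := ∫⁻ u : ℂ, ENNReal.ofReal (radial (3 / 2) 1 ‖u‖)
  set B := ∫⁻ u : ℂ, ENNReal.ofReal (radial 1 (3 / 2) ‖u‖)
  have hA : A ≠ ⊤ := (integrable_radial (by norm_num) (by norm_num)).lintegral_lt_top.ne
  have hB : B ≠ ⊤ := (integrable_radial (by norm_num) (by norm_num)).lintegral_lt_top.ne
  refine ⟨ENNReal.ofReal ((1 / 2) ^ (-(1 / 2) : ℝ)) * (A + B),
    ENNReal.mul_ne_top ENNReal.ofReal_ne_top (ENNReal.add_ne_top.2 ⟨hA, hB⟩), ?_⟩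
  intro ζ w hw
  have hd : 0 < ‖w - ζ‖ := norm_pos_iff.2 (sub_ne_zero.2 hw)
  -- For every `z`, the farther of `w` and `ζ` is at distance at least `d`, and at least as far as
  -- the nearer one. Its factor is therefore bounded using `max d` of the nearer distance.
  set d := ‖w - ζ‖ / 2 with hd'
  have hd2 : 0 < d := by positivity
  have key : ∀ᵐ z : ℂ, ‖z - w‖ₑ⁻¹ * (‖z - ζ‖ₑ⁻¹ * ENNReal.ofReal (‖z - ζ‖ ^ (-(1 / 2) : ℝ))) ≤
      ENNReal.ofReal (‖z - ζ‖ ^ (-(3 / 2) : ℝ) * (max d ‖z - ζ‖) ^ (-1 : ℝ)) +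
      ENNReal.ofReal (‖z - w‖ ^ (-1 : ℝ) * (max d ‖z - w‖) ^ (-(3 / 2) : ℝ)) := by
    -- At `z = w` the left side is `⊤`, while the real power `0 ^ (-1)` on the right is 0, so the
    -- singular points are discarded as null sets.
    have n1 : ∀ᵐ z : ℂ, z ≠ w := by simp [ae_iff]
    have n2 : ∀ᵐ z : ℂ, z ≠ ζ := by simp [ae_iff]
    filter_upwards [n1, n2] with z hzw hzζ
    have p1 : 0 < ‖z - w‖ := norm_pos_iff.2 (sub_ne_zero.2 hzw)
    have p2 : 0 < ‖z - ζ‖ := norm_pos_iff.2 (sub_ne_zero.2 hzζ)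
    rw [← ofReal_norm, ← ofReal_norm, ← ENNReal.ofReal_inv_of_pos p1,
      ← ENNReal.ofReal_inv_of_pos p2, ← ENNReal.ofReal_mul (by positivity),
      ← ENNReal.ofReal_mul (by positivity), ← ENNReal.ofReal_add (by positivity) (by positivity)]
    apply ENNReal.ofReal_le_ofReal
    have tri : ‖w - ζ‖ ≤ ‖z - w‖ + ‖z - ζ‖ := by
      rw [norm_sub_rev z w]; exact norm_sub_le_norm_sub_add_norm_sub _ _ _
    have e3 : ‖z - ζ‖⁻¹ * ‖z - ζ‖ ^ (-(1 / 2) : ℝ) = ‖z - ζ‖ ^ (-(3 / 2) : ℝ) := by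
      rw [← Real.rpow_neg_one, ← Real.rpow_add p2]; norm_num
    rw [e3, ← Real.rpow_neg_one]
    rcases le_total ‖z - ζ‖ ‖z - w‖ with h | h
    · refine le_add_of_le_of_nonneg ?_ (by positivity)
      rw [mul_comm]
      gcongr ?_ * ?_
      exact Real.rpow_le_rpow_of_nonpos (by positivity) (max_le (by linarith) h) (by norm_num)
    · refine le_add_of_nonneg_of_le (by positivity) ?_
      gcongr ?_ * ?_
      exact Real.rpow_le_rpow_of_nonpos (by positivity) (max_le (by linarith) h) (by norm_num)
  refine (lintegral_mono_ae key).trans ?_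
  rw [lintegral_add_left (by fun_prop), lintegral_radial_scale (3 / 2) 1 ζ hd2,
    lintegral_radial_scale 1 (3 / 2) w hd2]
  have e : d ^ (-(1 / 2) : ℝ) = (1 / 2) ^ (-(1 / 2) : ℝ) * ‖w - ζ‖ ^ (-(1 / 2) : ℝ) := by
    rw [hd', div_eq_mul_one_div, Real.mul_rpow hd.le (by norm_num), mul_comm]
  rw [show (2 - 3 / 2 - 1 : ℝ) = -(1 / 2) by norm_num,
    show (2 - 1 - 3 / 2 : ℝ) = -(1 / 2) by norm_num, e, ENNReal.ofReal_mul (by positivity)]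
  apply le_of_eq
  ring

/-! ### Schur's test and the `TT*` argument. -/

theorem two_mul_le_weighted_sq {p q : ℝ≥0∞} (hp : p ≠ 0) (hp' : p ≠ ⊤) (hq : q ≠ 0)
    (hq' : q ≠ ⊤) (a b : ℝ≥0∞) :
    2 * (a * b) ≤ a ^ 2 * (p⁻¹ * q) + b ^ 2 * (q⁻¹ * p) := by
  have h1 : p⁻¹ * q ≠ 0 := mul_ne_zero (ENNReal.inv_ne_zero.2 hp') hq
  have h2 : q⁻¹ * p ≠ 0 := mul_ne_zero (ENNReal.inv_ne_zero.2 hq') hp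
  rcases eq_or_ne a ⊤ with rfl | ha
  · simp [h1]
  rcases eq_or_ne b ⊤ with rfl | hb
  · simp [h2]
  lift p to NNReal using hp'
  lift q to NNReal using hq'
  lift a to NNReal using ha
  lift b to NNReal using hb
  have hp0 : p ≠ 0 := by exact_mod_cast hp
  have hq0 : q ≠ 0 := by exact_mod_cast hq
  rw [← ENNReal.coe_inv hp0, ← ENNReal.coe_inv hq0]
  norm_cast
  rw [← NNReal.coe_le_coe]
  push_cast
  have hp1 : (0 : ℝ) < p := by positivity
  have hq1 : (0 : ℝ) < q := by positivity
  have e : (a : ℝ) ^ 2 * ((p : ℝ)⁻¹ * q) + (b : ℝ) ^ 2 * ((q : ℝ)⁻¹ * p) - 2 * (a * b) =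
      (a * q - b * p) ^ 2 / (p * q) := by
    field_simp
    ring
  have : 0 ≤ ((a : ℝ) * q - b * p) ^ 2 / (p * q) := by positivity
  linarith

/-- **Schur's test** for a nonnegative symmetric kernel. -/
theorem lintegral_schur_le {X : Type*} [MeasurableSpace X] {ν : Measure X} [SFinite ν]
    {K : X → X → ℝ≥0∞} (hK : Measurable (Function.uncurry K)) (hsymm : ∀ x y, K x y = K y x)
    {u p : X → ℝ≥0∞} (hu : Measurable u) (hp : Measurable p)
    (hp0 : ∀ᵐ x ∂ν, p x ≠ 0 ∧ p x ≠ ⊤) {C : ℝ≥0∞}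
    (hC : ∀ᵐ x ∂ν, ∫⁻ y, K x y * p y ∂ν ≤ C * p x) :
    ∫⁻ x, ∫⁻ y, u x * (K x y * u y) ∂ν ∂ν ≤ C * ∫⁻ x, u x ^ 2 ∂ν := by
  -- By weighted AM-GM and symmetry of `K`, twice the integrand is at most `F x y + F y x`. The two
  -- halves have equal integrals by Tonelli, and integrating `F` first in `y` brings in the
  -- hypothesis on `p`.
  set F : X → X → ℝ≥0∞ := fun x y => u x ^ 2 * (p x)⁻¹ * (K x y * p y) with hF
  have hFm : Measurable (Function.uncurry F) := by
    have := (((hu.comp measurable_fst).pow_const 2).mul (hp.comp measurable_fst).inv).mul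
      (hK.mul (hp.comp measurable_snd))
    exact this
  have main : ∫⁻ x, ∫⁻ y, F x y ∂ν ∂ν ≤ C * ∫⁻ x, u x ^ 2 ∂ν := by
    rw [← lintegral_const_mul _ (by fun_prop)]
    refine lintegral_mono_ae ?_
    filter_upwards [hp0, hC] with x hx hx'
    have hm : Measurable fun y => K x y * p y := (hK.of_uncurry_left (x := x)).mul hp
    simp only [hF]
    rw [lintegral_const_mul _ hm]
    calc u x ^ 2 * (p x)⁻¹ * ∫⁻ y, K x y * p y ∂ν ≤ u x ^ 2 * (p x)⁻¹ * (C * p x) := by gcongr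
      _ = C * u x ^ 2 * ((p x)⁻¹ * p x) := by ring
      _ = C * u x ^ 2 := by rw [ENNReal.inv_mul_cancel hx.1 hx.2, mul_one]
  have swap : ∫⁻ x, ∫⁻ y, F y x ∂ν ∂ν = ∫⁻ x, ∫⁻ y, F x y ∂ν ∂ν :=
    (lintegral_lintegral_swap hFm.aemeasurable).symm
  have hle : ∫⁻ x, ∫⁻ y, 2 * (u x * (K x y * u y)) ∂ν ∂ν ≤
      ∫⁻ x, ∫⁻ y, (F x y + F y x) ∂ν ∂ν := by
    refine lintegral_mono_ae ?_
    filter_upwards [hp0] with x hx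
    refine lintegral_mono_ae ?_
    filter_upwards [hp0] with y hy
    simp only [hF]
    rw [hsymm y x]
    have amgm : 2 * (u x * u y) ≤ u x ^ 2 * ((p x)⁻¹ * p y) + u y ^ 2 * ((p y)⁻¹ * p x) :=
      two_mul_le_weighted_sq hx.1 hx.2 hy.1 hy.2 _ _
    calc 2 * (u x * (K x y * u y)) = K x y * (2 * (u x * u y)) := by ring
      _ ≤ K x y * (u x ^ 2 * ((p x)⁻¹ * p y) + u y ^ 2 * ((p y)⁻¹ * p x)) := by gcongr
      _ = _ := by ring
  have hFs : ∀ x, Measurable (F x) := fun x => hFm.of_uncurry_left (x := x)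
  simp only [lintegral_add_left (hFs _)] at hle
  rw [lintegral_add_left hFm.lintegral_prod_right, swap, ← two_mul] at hle
  simp only [lintegral_const_mul' 2 _ ENNReal.ofNat_ne_top] at hle
  exact ((ENNReal.mul_le_mul_iff_right two_ne_zero ENNReal.ofNat_ne_top).1 hle).trans main

/-- Let `I` be the integral to be bounded and `v = ∫ ⟨k x, a⟩ k x dν`. Then `I = ⟨a, v⟩ ≤ ‖a‖ ‖v‖`,
and expanding `‖v‖²` as a double integral gives `‖v‖² ≤ C I`. So `I² ≤ C I ‖a‖²`, and one divides by
`I`. The bound `B` and finiteness of `ν` ensure that `v` exists and `I < ∞`; neither enters the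
constant. -/
theorem lintegral_inner_sq_le {X H : Type*} [MeasurableSpace X] {ν : Measure X}
    [IsFiniteMeasure ν] [NormedAddCommGroup H] [InnerProductSpace ℂ H] [CompleteSpace H]
    {k : X → H} (hk : AEStronglyMeasurable k ν) {B : ℝ} (hB : ∀ᵐ x ∂ν, ‖k x‖ ≤ B) (a : H)
    {C : ℝ≥0∞} (hC : ∫⁻ x, ∫⁻ y, ‖inner ℂ (k x) a‖ₑ *
        (‖inner ℂ (k x) (k y)‖ₑ * ‖inner ℂ (k y) a‖ₑ) ∂ν ∂ν ≤
      C * ∫⁻ x, ‖inner ℂ (k x) a‖ₑ ^ 2 ∂ν) :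
    ∫⁻ x, ‖inner ℂ (k x) a‖ₑ ^ 2 ∂ν ≤ C * ‖a‖ₑ ^ 2 := by
  set g : X → ℂ := fun x => inner ℂ (k x) a with hg
  have hgm : AEStronglyMeasurable g ν := hk.inner aestronglyMeasurable_const
  have hgb : ∀ᵐ x ∂ν, ‖g x‖ ≤ B * ‖a‖ := by
    filter_upwards [hB] with x hx
    exact (norm_inner_le_norm _ _).trans (by gcongr)
  have hvi : Integrable (fun x => g x • k x) ν := by
    refine Integrable.of_bound (hgm.smul hk) (B * ‖a‖ * B) ?_
    filter_upwards [hB, hgb] with x h1 h2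
    rw [norm_smul]
    have := (norm_nonneg _).trans h2
    gcongr
  set v := ∫ x, g x • k x ∂ν with hv
  set I := ∫⁻ x, ‖g x‖ₑ ^ 2 ∂ν with hI
  have hgi : Integrable (fun x => ‖g x‖ ^ 2) ν := by
    refine Integrable.of_bound (hgm.norm.pow 2) ((B * ‖a‖) ^ 2) ?_
    filter_upwards [hgb] with x h
    rw [Real.norm_of_nonneg (by positivity)]
    gcongr
  have hIfin : I ≠ ⊤ := by
    have h2 := hgi.lintegral_lt_top
    simp only [ENNReal.ofReal_pow (norm_nonneg _), ofReal_norm] at h2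
    exact h2.ne
  have h1 : I ≤ ‖v‖ₑ * ‖a‖ₑ := by
    have e : (inner ℂ a v : ℂ) = ∫ x, ((‖g x‖ ^ 2 : ℝ) : ℂ) ∂ν := by
      rw [hv, ← integral_inner hvi]
      congr 1 with x
      rw [inner_smul_right, ← inner_conj_symm, Complex.mul_conj, Complex.normSq_eq_norm_sq]
    have e2 : I = ‖(inner ℂ a v : ℂ)‖ₑ := by
      rw [e.trans integral_complex_ofReal, ← ofReal_norm, Complex.norm_real,
        Real.norm_of_nonneg (integral_nonneg fun x => by positivity),
        ofReal_integral_eq_lintegral_ofReal hgi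
          (Filter.Eventually.of_forall fun x => by positivity)]
      simp only [ENNReal.ofReal_pow (norm_nonneg _), ofReal_norm]
      rfl
    rw [e2, mul_comm]
    simp only [← ofReal_norm]
    rw [← ENNReal.ofReal_mul (norm_nonneg _)]
    exact ENNReal.ofReal_le_ofReal (norm_inner_le_norm _ _)
  have h2 : ‖v‖ₑ ^ 2 ≤ C * I := by
    refine le_trans ?_ hC
    have e : ‖v‖ₑ ^ 2 = ‖(inner ℂ v v : ℂ)‖ₑ := by
      rw [inner_self_eq_norm_sq_to_K, enorm_pow, ← ofReal_norm, ← ofReal_norm]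
      simp
    rw [e]
    nth_rw 2 [hv]
    rw [← integral_inner hvi]
    refine (enorm_integral_le_lintegral_enorm _).trans (lintegral_mono fun x => ?_)
    dsimp only
    rw [inner_smul_right, enorm_mul, lintegral_const_mul' _ _ (by simp)]
    gcongr
    rw [← inner_conj_symm, RCLike.enorm_conj, hv, ← integral_inner hvi]
    refine (enorm_integral_le_lintegral_enorm _).trans (lintegral_mono fun y => ?_)
    rw [inner_smul_right, enorm_mul, mul_comm]
  have h3 : I * I ≤ I * (C * ‖a‖ₑ ^ 2) := by
    calc I * I ≤ (‖v‖ₑ * ‖a‖ₑ) * (‖v‖ₑ * ‖a‖ₑ) := by gcongr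
      _ = ‖v‖ₑ ^ 2 * ‖a‖ₑ ^ 2 := by ring
      _ ≤ C * I * ‖a‖ₑ ^ 2 := by gcongr
      _ = _ := by ring
  rcases eq_or_ne I 0 with h0 | h0
  · rw [h0]; exact zero_le
  · exact (ENNReal.mul_le_mul_iff_right h0 hIfin).1 h3

/-! ### Orthonormal expansions and means over circles. -/

theorem Orthonormal.hasSum_inner {H : Type*} [NormedAddCommGroup H] [InnerProductSpace ℂ H]
    {e : ℕ → H} (he : Orthonormal ℂ e) {c d : ℕ → ℂ} {v w : H}
    (hv : HasSum (fun n => c n • e n) v) (hw : HasSum (fun n => d n • e n) w) :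
    HasSum (fun n => (starRingEnd ℂ) (c n) * d n) (inner ℂ v w) := by
  have hc (n : ℕ) : inner ℂ v (e n) = (starRingEnd ℂ) (c n) := by
    rw [← inner_conj_symm]
    congr 1
    have h := hv.mapL (innerSL ℂ (e n))
    simp only [innerSL_apply_apply, inner_smul_right, orthonormal_iff_ite.1 he] at h
    have e1 : (fun m => c m * if n = m then 1 else 0) = fun m => if m = n then c n else 0 := by
      funext m
      by_cases h : m = n
      · simp [h]
      · simp [h, Ne.symm h]
    rw [e1] at h
    exact h.unique (hasSum_ite_eq n (c n))
  have h := hw.mapL (innerSL ℂ v)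
  simp only [innerSL_apply_apply, inner_smul_right, hc] at h
  exact h.congr_fun fun n => mul_comm _ _

theorem Orthonormal.hasSum_norm_sq {H : Type*} [NormedAddCommGroup H] [InnerProductSpace ℂ H]
    {e : ℕ → H} (he : Orthonormal ℂ e) {c : ℕ → ℂ} {v : H} (hv : HasSum (fun n => c n • e n) v) :
    HasSum (fun n => ‖c n‖ ^ 2) (‖v‖ ^ 2) := by
  have h := (Orthonormal.hasSum_inner he hv hv).mapL Complex.reCLM
  simp only [← Complex.normSq_eq_conj_mul_self, Complex.reCLM_apply,
    Complex.ofReal_re, Complex.normSq_eq_norm_sq] at h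
  rw [inner_self_eq_norm_sq_to_K] at h
  convert h using 1
  norm_cast

/-- Absolute summability makes the Fourier series converge uniformly on the circle group, hence in
`L²`, where the exponentials are orthonormal. The circle mean is the integral against normalized
Haar measure. -/
theorem circleMean_sq_of_hasSum {c : ℕ → ℂ} (hc : Summable fun n => ‖c n‖) {G : ℝ → ℂ}
    (hG : ∀ t : ℝ, HasSum (fun n : ℕ => c n * Complex.exp (n * t * Complex.I)) (G t)) :
    HasSum (fun n => ‖c n‖ ^ 2) (circleMean fun t => ‖G t‖ₑ ^ 2).toReal ∧
      (circleMean fun t => ‖G t‖ₑ ^ 2) ≠ ⊤ := by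
  have : Fact (0 < 2 * Real.pi) := ⟨Real.two_pi_pos⟩
  have hs : Summable fun n : ℕ => c n • (fourier (T := 2 * Real.pi) (n : ℤ)) := by
    refine Summable.of_norm ?_
    simpa only [norm_smul, fourier_norm, mul_one] using hc
  obtain ⟨F, hF⟩ := hs
  have hFG (t : ℝ) : F (t : AddCircle (2 * Real.pi)) = G t := by
    have h := hF.mapL (ContinuousMap.evalCLM ℂ (t : AddCircle (2 * Real.pi)))
    simp only [ContinuousMap.evalCLM_apply, ContinuousMap.smul_apply, fourier_coe_apply,
      smul_eq_mul] at h
    refine h.unique ?_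
    convert hG t using 4 with n
    push_cast
    field_simp
  set v := ContinuousMap.toLp (E := ℂ) 2 (@AddCircle.haarAddCircle (2 * Real.pi) _) ℂ F with hv
  have hvs : HasSum (fun n : ℕ => c n • fourierLp (T := 2 * Real.pi) 2 (n : ℤ)) v := by
    have h := hF.mapL (ContinuousMap.toLp (E := ℂ) 2 (@AddCircle.haarAddCircle (2 * Real.pi) _) ℂ)
    simpa only [map_smul] using h
  have hn := Orthonormal.hasSum_norm_sq
    (orthonormal_fourier.comp (fun n : ℕ => (n : ℤ)) Nat.cast_injective) hvs
  have e : (circleMean fun t => ‖G t‖ₑ ^ 2) = ‖v‖ₑ ^ 2 := by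
    have h1 : ‖v‖ₑ ^ 2 = ∫⁻ x, ‖F x‖ₑ ^ 2 ∂(@AddCircle.haarAddCircle (2 * Real.pi) _) := by
      rw [Lp.enorm_def, eLpNorm_congr_ae (ContinuousMap.coeFn_toLp _ F)]
      have := eLpNorm_nnreal_pow_eq_lintegral (f := F) (p := 2)
        (μ := @AddCircle.haarAddCircle (2 * Real.pi) _) two_ne_zero
      simpa using this
    have h2 : ∫⁻ x, ‖F x‖ₑ ^ 2 ∂(volume : Measure (AddCircle (2 * Real.pi))) =
        ∫⁻ t in Set.Icc 0 (2 * Real.pi), ‖G t‖ₑ ^ 2 := by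
      rw [← AddCircle.lintegral_preimage (2 * Real.pi) 0, zero_add,
        setLIntegral_congr Ioc_ae_eq_Icc]
      simp only [hFG]
    rw [AddCircle.volume_eq_smul_haarAddCircle, lintegral_smul_measure, ← h1] at h2
    unfold circleMean
    rw [← h2, smul_eq_mul, ← mul_assoc, ENNReal.inv_mul_cancel _ ENNReal.ofReal_ne_top, one_mul]
    exact (ENNReal.ofReal_pos.2 Real.two_pi_pos).ne'
  rw [e]
  refine ⟨?_, by simp⟩
  simpa using hn

/-- Power series coefficients and **Parseval's identity** on the disc. -/
theorem exists_coeff_parseval {g : ℂ → ℂ} (hg : DifferentiableOn ℂ g (Metric.ball 0 1)) :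
    ∃ a : ℕ → ℂ, (∀ z ∈ Metric.ball (0 : ℂ) 1, HasSum (fun n => a n * z ^ n) (g z)) ∧
      ∀ ρ ∈ Set.Ioo (0 : ℝ) 1, (Summable fun n => ‖a n * (ρ : ℂ) ^ n‖) ∧
        HasSum (fun n => ‖a n * (ρ : ℂ) ^ n‖ ^ 2)
          (circleMean fun t => ‖g (circleMap 0 ρ t)‖ₑ ^ 2).toReal ∧
        (circleMean fun t => ‖g (circleMap 0 ρ t)‖ₑ ^ 2) ≠ ⊤ := by
  have h1 : ∀ z ∈ Metric.ball (0 : ℂ) 1, HasSum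
      (fun n : ℕ => ((n.factorial : ℂ)⁻¹ * iteratedDeriv n g 0) * z ^ n) (g z) := by
    intro z hz
    have h := Complex.hasSum_taylorSeries_on_ball hg hz
    simp only [sub_zero, smul_eq_mul] at h
    refine h.congr_fun fun n => ?_
    ring
  refine ⟨_, h1, fun ρ hρ => ?_⟩
  have hs := (h1 (ρ : ℂ) (by simpa [abs_of_pos hρ.1] using hρ.2)).summable.norm
  refine ⟨hs, circleMean_sq_of_hasSum hs fun t => ?_⟩
  convert h1 _ (circle_mem hρ t) using 2 with n
  rw [circleMap_zero, mul_pow, ← Complex.exp_nat_mul]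
  ring_nf

/-- By Parseval the mean at radius `r` is `∑ |a_n|² r^{2n}`, each term of which increases with `r`.
-/
theorem circleMean_mono_radius {g : ℂ → ℂ} (hg : DifferentiableOn ℂ g (Metric.ball 0 1))
    {r ρ : ℝ} (hr : 0 < r) (hrρ : r ≤ ρ) (hρ : ρ < 1) :
    (circleMean fun t => ‖g (circleMap 0 r t)‖ₑ ^ 2) ≤
      circleMean fun t => ‖g (circleMap 0 ρ t)‖ₑ ^ 2 := by
  obtain ⟨a, -, h⟩ := exists_coeff_parseval hg
  obtain ⟨-, h1, h1'⟩ := h r ⟨hr, hrρ.trans_lt hρ⟩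
  obtain ⟨-, h2, h2'⟩ := h ρ ⟨hr.trans_le hrρ, hρ⟩
  rw [← ENNReal.toReal_le_toReal h1' h2']
  refine hasSum_le (fun n => ?_) h1 h2
  simp only [norm_mul, norm_pow, Complex.norm_real, Real.norm_of_nonneg hr.le,
    Real.norm_of_nonneg (hr.le.trans hrρ)]
  gcongr

/-! ### Szegő kernel vectors and the Carleson embedding. -/

theorem setLIntegral_inv_enorm_sub_ne_top (R : ℝ) (ζ : ℂ) :
    ∫⁻ z in Metric.ball (0 : ℂ) R, ‖z - ζ‖ₑ⁻¹ ≠ ⊤ := by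
  have hI : ∫⁻ z : ℂ, ENNReal.ofReal (radial 1 2 ‖z - ζ‖) ≠ ⊤ := by
    rw [lintegral_sub_right_eq_self (fun z : ℂ => ENNReal.ofReal (radial 1 2 ‖z‖)) ζ]
    exact (integrable_radial (by norm_num) (by norm_num)).lintegral_lt_top.ne
  have hV : volume (Metric.ball (0 : ℂ) R) ≠ ⊤ := measure_ball_lt_top.ne
  have n2 : ∀ᵐ z ∂(volume.restrict (Metric.ball (0 : ℂ) R)), z ≠ ζ :=
    ae_restrict_of_ae (by simp [ae_iff])
  refine ne_top_of_le_ne_top (ENNReal.add_ne_top.2 ⟨hI, hV⟩) ?_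
  calc ∫⁻ z in Metric.ball (0 : ℂ) R, ‖z - ζ‖ₑ⁻¹
      ≤ ∫⁻ z in Metric.ball (0 : ℂ) R, (ENNReal.ofReal (radial 1 2 ‖z - ζ‖) + 1) := by
        refine lintegral_mono_ae ?_
        filter_upwards [n2] with z hz
        have p1 : 0 < ‖z - ζ‖ := norm_pos_iff.2 (sub_ne_zero.2 hz)
        rw [← ofReal_norm, ← ENNReal.ofReal_inv_of_pos p1]
        rcases le_total ‖z - ζ‖ 1 with h | h
        · refine le_add_of_le_of_nonneg (ENNReal.ofReal_le_ofReal ?_) zero_le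
          rw [radial, max_eq_left h, Real.rpow_neg_one, Real.one_rpow, mul_one]
        · refine le_add_of_nonneg_of_le zero_le ?_
          rw [← ENNReal.ofReal_one]
          exact ENNReal.ofReal_le_ofReal (inv_le_one_of_one_le₀ h)
    _ = (∫⁻ z in Metric.ball (0 : ℂ) R, ENNReal.ofReal (radial 1 2 ‖z - ζ‖)) +
          volume (Metric.ball (0 : ℂ) R) := by
        rw [lintegral_add_right _ measurable_const]; simp
    _ ≤ _ := add_le_add_left (setLIntegral_le_lintegral _ _) _

/-- Vectors representing point evaluations at the points of the disc of radius `ρ`. -/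
noncomputable def diskKernel {H : Type*} [NormedAddCommGroup H] [InnerProductSpace ℂ H] (e : ℕ → H) (ρ : ℝ)
    (z : ℂ) : H :=
  ∑' n : ℕ, ((starRingEnd ℂ) z / ρ) ^ n • e n

section DiskKernel

variable {H : Type*} [NormedAddCommGroup H] [InnerProductSpace ℂ H]
  {e : ℕ → H}

theorem norm_diskKernel_term (he : Orthonormal ℂ e) {ρ : ℝ} (hρ : 0 < ρ) (z : ℂ) (n : ℕ) :
    ‖((starRingEnd ℂ) z / ρ) ^ n • e n‖ = (‖z‖ / ρ) ^ n := by
  rw [norm_smul, he.1, mul_one, norm_pow, norm_div, RCLike.norm_conj, Complex.norm_real,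
    Real.norm_of_nonneg hρ.le]

theorem hasSum_diskKernel [CompleteSpace H] (he : Orthonormal ℂ e) {ρ : ℝ} {z : ℂ} (hz : ‖z‖ < ρ) :
    HasSum (fun n : ℕ => ((starRingEnd ℂ) z / ρ) ^ n • e n) (diskKernel e ρ z) := by
  have hρ : 0 < ρ := (norm_nonneg z).trans_lt hz
  refine Summable.hasSum (Summable.of_norm ?_)
  simp only [norm_diskKernel_term he hρ]
  exact summable_geometric_of_lt_one (by positivity) ((div_lt_one hρ).2 hz)

theorem norm_diskKernel_le (he : Orthonormal ℂ e) {R ρ : ℝ} (hR : R < ρ) {z : ℂ} (hz : ‖z‖ < R) :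
    ‖diskKernel e ρ z‖ ≤ (1 - R / ρ)⁻¹ := by
  have hR0 : 0 < R := (norm_nonneg z).trans_lt hz
  have hρ : 0 < ρ := hR0.trans hR
  refine tsum_of_norm_bounded
    (hasSum_geometric_of_lt_one (by positivity) ((div_lt_one hρ).2 hR)) fun n => ?_
  rw [norm_diskKernel_term he hρ]
  gcongr

theorem continuousOn_diskKernel [CompleteSpace H] (he : Orthonormal ℂ e) {R ρ : ℝ} (hR0 : 0 < R) (hR : R < ρ) :
    ContinuousOn (diskKernel e ρ) (Metric.ball 0 R) := by
  have hρ : 0 < ρ := hR0.trans hR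
  refine continuousOn_tsum (u := fun n => (R / ρ) ^ n) (fun n => ?_)
    (summable_geometric_of_lt_one (by positivity) ((div_lt_one hρ).2 hR)) fun n z hz => ?_
  · have : Continuous fun z : ℂ => ((starRingEnd ℂ) z / ρ) ^ n • e n :=
      ((Complex.continuous_conj.div_const _).pow n).smul continuous_const
    exact this.continuousOn
  · rw [norm_diskKernel_term he hρ]
    have : ‖z‖ < R := by simpa using hz
    gcongr

/-- The expansion is a geometric series, whose sum is the Szegő kernel rescaled to radius `ρ`. -/
theorem inner_diskKernel [CompleteSpace H] (he : Orthonormal ℂ e) {ρ : ℝ} {z w : ℂ} (hz : ‖z‖ < ρ) (hw : ‖w‖ < ρ) :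
    inner ℂ (diskKernel e ρ z) (diskKernel e ρ w) =
      (1 - (starRingEnd ℂ) (w / ρ) * (z / ρ))⁻¹ := by
  have hρ : 0 < ρ := (norm_nonneg z).trans_lt hz
  have h := Orthonormal.hasSum_inner he (hasSum_diskKernel he hz) (hasSum_diskKernel he hw)
  refine h.unique ?_
  have hn : ‖(starRingEnd ℂ) (w / ρ) * (z / ρ)‖ < 1 := by
    rw [norm_mul, RCLike.norm_conj, norm_div, norm_div, Complex.norm_real,
      Real.norm_of_nonneg hρ.le]
    exact mul_lt_one_of_nonneg_of_lt_one_left (by positivity) ((div_lt_one hρ).2 hw)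
      ((div_lt_one hρ).2 hz).le
  refine (hasSum_geometric_of_norm_lt_one hn).congr_fun fun n => ?_
  simp only [map_pow, map_div₀, Complex.conj_conj, Complex.conj_ofReal]
  rw [← mul_pow, mul_comm]

/-- For points `z/ρ`, `w/ρ` of the unit disc, `norm_sub_sq_add_eq` shows that the Szegő denominator
is at least `|z - w| / ρ`, and `ρ ≤ 1` removes the factor. -/
theorem enorm_inner_diskKernel_le [CompleteSpace H] (he : Orthonormal ℂ e) {ρ : ℝ} (hρ1 : ρ ≤ 1) {z w : ℂ}
    (hz : ‖z‖ < ρ) (hw : ‖w‖ < ρ) :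
    ‖inner ℂ (diskKernel e ρ z) (diskKernel e ρ w)‖ₑ ≤ ‖z - w‖ₑ⁻¹ := by
  have hρ : 0 < ρ := (norm_nonneg z).trans_lt hz
  rcases eq_or_ne z w with rfl | hne
  · simp
  have hy : 0 < ‖z - w‖ := norm_pos_iff.2 (sub_ne_zero.2 hne)
  rw [inner_diskKernel he hz hw, ← ofReal_norm, ← ofReal_norm, ← ENNReal.ofReal_inv_of_pos hy,
    norm_inv]
  refine ENNReal.ofReal_le_ofReal (inv_anti₀ hy ?_)
  have hz1 : ‖z / ρ‖ < 1 := by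
    rw [norm_div, Complex.norm_real, Real.norm_of_nonneg hρ.le]; exact (div_lt_one hρ).2 hz
  have hw1 : ‖w / ρ‖ < 1 := by
    rw [norm_div, Complex.norm_real, Real.norm_of_nonneg hρ.le]; exact (div_lt_one hρ).2 hw
  have e1 := norm_sub_sq_add_eq (w / ρ) (z / ρ)
  have e2 : ‖z / ρ - w / ρ‖ = ‖z - w‖ / ρ := by
    rw [← sub_div, norm_div, Complex.norm_real, Real.norm_of_nonneg hρ.le]
  have h1 : 0 ≤ (1 - ‖w / ρ‖ ^ 2) * (1 - ‖z / ρ‖ ^ 2) := by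
    apply mul_nonneg <;> nlinarith [norm_nonneg (w / ρ), norm_nonneg (z / ρ)]
  have h2 : ‖z / ρ - w / ρ‖ ≤ ‖1 - (starRingEnd ℂ) (w / ρ) * (z / ρ)‖ :=
    le_of_sq_le_sq (by rw [e1]; linarith) (norm_nonneg _)
  refine le_trans ?_ h2
  rw [e2]
  exact le_div_self hy.le hρ hρ1

end DiskKernel

/-- The measures `dA / |z - ζ|` are Carleson measures of the disc, uniformly in `ζ`. -/
theorem exists_carleson_le : ∃ C : ℝ≥0∞, C ≠ ⊤ ∧ ∀ (ζ : ℂ) (g : ℂ → ℂ),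
    DifferentiableOn ℂ g (Metric.ball 0 1) → ∀ R ρ : ℝ, 0 < R → R < ρ → ρ < 1 →
    ∫⁻ z in Metric.ball (0 : ℂ) R, ‖g z‖ₑ ^ 2 * ‖z - ζ‖ₑ⁻¹ ≤
      C * circleMean fun t => ‖g (circleMap 0 ρ t)‖ₑ ^ 2 := by
  obtain ⟨C, hC, hriesz⟩ := exists_lintegral_riesz_le
  refine ⟨C, hC, fun ζ g hg R ρ hR0 hR hρ1 => ?_⟩
  have hρ : 0 < ρ := hR0.trans hR
  -- `ℓ²` models the Hardy space on the circle of radius `ρ`: the vector `v` with coordinates `a n *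
  -- ρ ^ n` has the circle mean as squared norm, and pairing it with `k z` evaluates `g` at `z`.
  let b : HilbertBasis ℕ ℂ (lp (fun _ : ℕ => ℂ) 2) :=
    HilbertBasis.ofRepr (LinearIsometryEquiv.refl ℂ _)
  have he := b.orthonormal
  obtain ⟨a, ha, hP⟩ := exists_coeff_parseval hg
  obtain ⟨hs, hsum, hfin⟩ := hP ρ ⟨hρ, hρ1⟩
  have hs' : Summable fun n : ℕ => (a n * (ρ : ℂ) ^ n) • b n := by
    refine Summable.of_norm ?_
    simpa only [norm_smul, he.1, mul_one] using hs
  obtain ⟨v, hv⟩ := hs'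
  have hvn : ‖v‖ₑ ^ 2 = circleMean fun t => ‖g (circleMap 0 ρ t)‖ₑ ^ 2 := by
    rw [← ENNReal.ofReal_toReal hfin, hsum.unique (Orthonormal.hasSum_norm_sq he hv),
      ENNReal.ofReal_pow (norm_nonneg _), ofReal_norm]
  set k := diskKernel b ρ with hk
  have hkv : ∀ z ∈ Metric.ball (0 : ℂ) R, inner ℂ (k z) v = g z := by
    intro z hz
    have hzR : ‖z‖ < R := by simpa using hz
    refine (Orthonormal.hasSum_inner he (hasSum_diskKernel he (hzR.trans hR)) hv).unique ?_
    refine (ha z (by simpa using hzR.trans (hR.trans hρ1))).congr_fun fun n => ?_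
    have : (ρ : ℂ) ≠ 0 := by exact_mod_cast hρ.ne'
    simp only [map_pow, map_div₀, Complex.conj_conj, Complex.conj_ofReal]
    rw [div_pow]
    field_simp
  set W : ℂ → ℝ≥0∞ := fun z => ‖z - ζ‖ₑ⁻¹ with hW
  have hWm : Measurable W := by fun_prop
  set ν₀ := volume.restrict (Metric.ball (0 : ℂ) R) with hν₀
  -- The singular weight goes into the measure. It is integrable on bounded discs, so `ν` is finite,
  -- and `R < ρ` keeps the kernel vectors bounded on its support.
  set ν := ν₀.withDensity W with hν
  have : IsFiniteMeasure ν :=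
    isFiniteMeasure_withDensity (setLIntegral_inv_enorm_sub_ne_top R ζ)
  have hac : ν ≪ ν₀ := withDensity_absolutelyContinuous _ _
  have hball : ∀ᵐ z ∂ν, z ∈ Metric.ball (0 : ℂ) R :=
    hac.ae_le (ae_restrict_mem measurableSet_ball)
  have hne : ∀ᵐ z ∂ν, z ≠ ζ := by
    refine hac.ae_le (ae_restrict_of_ae (by simp [ae_iff]))
  have hkm : AEStronglyMeasurable k ν :=
    ((continuousOn_diskKernel he hR0 hR).aestronglyMeasurable measurableSet_ball).mono_ac hac
  have hkb : ∀ᵐ z ∂ν, ‖k z‖ ≤ (1 - R / ρ)⁻¹ := by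
    filter_upwards [hball] with z hz
    exact norm_diskKernel_le he hR (by simpa using hz)
  have hgm : AEMeasurable (fun z => ‖inner ℂ (k z) v‖ₑ) ν :=
    (hkm.inner aestronglyMeasurable_const).enorm
  obtain ⟨u, hum, hu⟩ := hgm
  -- Together with the density `1 / |z - ζ|` this test function produces the exponent `-3/2` of the
  -- Riesz estimate, which returns `C * p`.
  set p : ℂ → ℝ≥0∞ := fun z => ENNReal.ofReal (‖z - ζ‖ ^ (-(1 / 2) : ℝ)) with hp
  have hpm : Measurable p := by fun_prop
  have hKm : Measurable (Function.uncurry fun z w : ℂ => ‖z - w‖ₑ⁻¹) := by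
    have : Measurable fun q : ℂ × ℂ => ‖q.1 - q.2‖ₑ⁻¹ := by fun_prop
    exact this
  have schur := lintegral_schur_le (ν := ν) (K := fun z w : ℂ => ‖z - w‖ₑ⁻¹) hKm
    (fun z w => by rw [← enorm_neg, neg_sub]) hum hpm (C := C) (by
      filter_upwards [hne] with z hz
      refine ⟨?_, ENNReal.ofReal_ne_top⟩
      have : 0 < ‖z - ζ‖ := norm_pos_iff.2 (sub_ne_zero.2 hz)
      exact (ENNReal.ofReal_pos.2 (by positivity)).ne') (by
      filter_upwards [hne] with w hw
      rw [hν, lintegral_withDensity_eq_lintegral_mul _ hWm (by fun_prop)]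
      refine le_trans ?_ (hriesz ζ w hw)
      refine (setLIntegral_le_lintegral _ _).trans (lintegral_mono fun z => ?_)
      simp only [Pi.mul_apply, hW, hp]
      rw [← enorm_neg (w - z), neg_sub]
      apply le_of_eq
      ring)
  have hmain := lintegral_inner_sq_le hkm hkb v (C := C) (by
    calc _ ≤ ∫⁻ z, ∫⁻ w, u z * (‖z - w‖ₑ⁻¹ * u w) ∂ν ∂ν := by
          refine lintegral_mono_ae ?_
          filter_upwards [hball, hu] with z hz huz
          refine lintegral_mono_ae ?_
          filter_upwards [hball, hu] with w hw huw
          rw [huz, huw]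
          gcongr
          exact enorm_inner_diskKernel_le he hρ1.le
            (lt_trans (by simpa using hz) hR) (lt_trans (by simpa using hw) hR)
      _ ≤ C * ∫⁻ z, u z ^ 2 ∂ν := schur
      _ = _ := by
          congr 1
          refine lintegral_congr_ae ?_
          filter_upwards [hu] with z hz
          rw [hz])
  rw [hvn] at hmain
  refine le_trans (le_of_eq ?_) hmain
  have e1 : ∫⁻ z, ‖inner ℂ (k z) v‖ₑ ^ 2 ∂ν =
      ∫⁻ z in Metric.ball (0 : ℂ) R, W z * ‖inner ℂ (k z) v‖ₑ ^ 2 := by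
    refine lintegral_withDensity_eq_lintegral_mul₀ hWm.aemeasurable ?_
    exact ((((continuousOn_diskKernel he hR0 hR).aestronglyMeasurable
      measurableSet_ball).inner aestronglyMeasurable_const).enorm.pow_const 2)
  rw [e1]
  refine setLIntegral_congr_fun measurableSet_ball fun z hz => ?_
  rw [hkv z hz, mul_comm]

theorem exists_weighted_carleson_le : ∃ C : ℝ≥0∞, C ≠ ⊤ ∧ ∀ (μ : Measure ClosedDisc)
    [IsFiniteMeasure μ] (g : ℂ → ℂ), Measurable g → DifferentiableOn ℂ g (Metric.ball 0 1) →
    ∀ R ρ : ℝ, 0 < R → R < ρ → ρ < 1 →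
    ∫⁻ z in Metric.ball (0 : ℂ) R, ‖g z‖ₑ ^ 2 * weight μ z ≤
      C * μ Set.univ * circleMean fun t => ‖g (circleMap 0 ρ t)‖ₑ ^ 2 := by
  obtain ⟨C, hC, h⟩ := exists_carleson_le
  refine ⟨ENNReal.ofReal 4 * C, ENNReal.mul_ne_top ENNReal.ofReal_ne_top hC, ?_⟩
  intro μ _ g hgm hg R ρ hR0 hR hρ
  set A := circleMean fun t => ‖g (circleMap 0 ρ t)‖ₑ ^ 2
  have hm : Measurable (Function.uncurry fun (z : ℂ) (ζ : ClosedDisc) =>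
      ‖g z‖ₑ ^ 2 * ‖z - (ζ : ℂ)‖ₑ⁻¹) := by
    have : Measurable fun q : ℂ × ClosedDisc => ‖g q.1‖ₑ ^ 2 * ‖q.1 - (q.2 : ℂ)‖ₑ⁻¹ := by
      fun_prop
    exact this
  calc ∫⁻ z in Metric.ball (0 : ℂ) R, ‖g z‖ₑ ^ 2 * weight μ z
      ≤ ∫⁻ z in Metric.ball (0 : ℂ) R, ENNReal.ofReal 4 *
          ∫⁻ ζ, ‖g z‖ₑ ^ 2 * ‖z - (ζ : ℂ)‖ₑ⁻¹ ∂μ := by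
        refine setLIntegral_mono' measurableSet_ball fun z hz => ?_
        have hz1 : ‖z‖ < 1 := lt_trans (by simpa using hz) (hR.trans hρ)
        rw [lintegral_const_mul' _ _ (by simp), mul_left_comm]
        gcongr
        exact weight_le μ hz1
    _ = ENNReal.ofReal 4 * ∫⁻ ζ : ClosedDisc, ∫⁻ z in Metric.ball (0 : ℂ) R,
          ‖g z‖ₑ ^ 2 * ‖z - (ζ : ℂ)‖ₑ⁻¹ ∂volume ∂μ := by
        rw [lintegral_const_mul' _ _ ENNReal.ofReal_ne_top,
          lintegral_lintegral_swap hm.aemeasurable]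
    _ ≤ ENNReal.ofReal 4 * ∫⁻ _ : ClosedDisc, C * A ∂μ := by
        gcongr with ζ
        exact h ζ g hg R ρ hR0 hR hρ
    _ = _ := by rw [lintegral_const]; ring

/-! ### From slices to the Hardy space of the bidisc. -/

theorem circleMean_swap {F : ℝ → ℝ → ℝ≥0∞} (hF : Measurable (Function.uncurry F)) :
    (circleMean fun s => circleMean fun t => F s t) =
      circleMean fun t => circleMean fun s => F s t := by
  have hc : (ENNReal.ofReal (2 * Real.pi))⁻¹ ≠ ⊤ :=
    ENNReal.inv_ne_top.2 (ENNReal.ofReal_pos.2 Real.two_pi_pos).ne'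
  unfold circleMean
  rw [lintegral_const_mul' _ _ hc, lintegral_const_mul' _ _ hc,
    lintegral_lintegral_swap hF.aemeasurable]

theorem circleMean_iSup {g : ℕ → ℝ → ℝ≥0∞} (hg : ∀ n, Measurable (g n)) (hm : Monotone g) :
    (circleMean fun θ => ⨆ n, g n θ) = ⨆ n, circleMean (g n) := by
  unfold circleMean
  rw [lintegral_iSup hg hm, ENNReal.mul_iSup]

open Classical in
theorem measurable_zeroExt {f : bidisc → ℂ} (hf : IsHolo f) : Measurable (zeroExt f) := by
  have h : zeroExt f = bidisc.piecewise (zeroExt f) 0 := by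
    ext z
    by_cases hz : z ∈ bidisc <;> simp [hz, zeroExt]
  rw [h]
  exact hf.continuousOn.measurable_piecewise continuousOn_const isOpen_bidisc.measurableSet

theorem IsHolo.slice_fst {f : bidisc → ℂ} (hf : IsHolo f) {w : ℂ} (hw : w ∈ Metric.ball (0 : ℂ) 1) :
    DifferentiableOn ℂ (fun z => zeroExt f (z, w)) (Metric.ball 0 1) :=
  DifferentiableOn.comp (t := bidisc) hf (by fun_prop) (fun _ hz => ⟨hz, hw⟩)

theorem IsHolo.slice_snd {f : bidisc → ℂ} (hf : IsHolo f) {z : ℂ} (hz : z ∈ Metric.ball (0 : ℂ) 1) :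
    DifferentiableOn ℂ (fun w => zeroExt f (z, w)) (Metric.ball 0 1) :=
  DifferentiableOn.comp (t := bidisc) hf (by fun_prop) (fun _ hw => ⟨hz, hw⟩)

/-- The Hardy norm uses equal radii in both variables, so the smaller radius `r` is first raised to
`ρ` by monotonicity of means in the second variable. -/
theorem circleMean_circleMean_le_hardySq {f : bidisc → ℂ} (hf : IsHolo f) {r ρ : ℝ} (hr : 0 < r)
    (hrρ : r ≤ ρ) (hρ : ρ < 1) :
    (circleMean fun θ => circleMean fun t =>
      ‖zeroExt f (circleMap 0 ρ t, circleMap 0 r θ)‖ₑ ^ 2) ≤ hardySq f := by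
  have hm : Measurable (Function.uncurry fun θ t : ℝ =>
      ‖zeroExt f (circleMap 0 ρ t, circleMap 0 r θ)‖ₑ ^ 2) :=
    ((measurable_zeroExt hf).comp (by fun_prop :
      Measurable fun q : ℝ × ℝ => (circleMap 0 ρ q.2, circleMap 0 r q.1))).enorm.pow_const 2
  have hρ' : ρ ∈ Set.Ioo (0 : ℝ) 1 := ⟨hr.trans_le hrρ, hρ⟩
  rw [circleMean_swap hm]
  refine le_trans (circleMean_mono fun t => ?_) (le_iSup₂_of_le ρ hρ' le_rfl)
  exact circleMean_mono_radius (hf.slice_snd (circle_mem hρ' t)) hr hrρ hρ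

theorem ball_eq_iUnion_ball :
    Metric.ball (0 : ℂ) 1 = ⋃ n : ℕ, Metric.ball (0 : ℂ) (1 - 1 / ((n : ℝ) + 2)) := by
  ext z
  simp only [mem_ball_zero_iff, Set.mem_iUnion]
  constructor
  · intro hz
    obtain ⟨n, hn⟩ := exists_nat_one_div_lt (sub_pos.2 hz)
    refine ⟨n, ?_⟩
    have : 1 / ((n : ℝ) + 2) ≤ 1 / ((n : ℝ) + 1) := by gcongr; norm_num
    linarith
  · rintro ⟨n, hn⟩
    have : 0 < 1 / ((n : ℝ) + 2) := by positivity
    linarith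

/-- This is the Carleson embedding applied to each slice and averaged over `θ`. As it only covers
discs of radius `R < ρ < 1`, the unit disc is exhausted by smaller ones and monotone convergence is
used. -/
theorem exists_mean_weight_le : ∃ C : ℝ≥0∞, C ≠ ⊤ ∧ ∀ (μ : Measure ClosedDisc)
    [IsFiniteMeasure μ] (f : bidisc → ℂ), IsHolo f → ∀ r ∈ Set.Ioo (0 : ℝ) 1,
    (circleMean fun θ => ∫⁻ z, ‖zeroExt f (z, circleMap 0 r θ)‖ₑ ^ 2 * weight μ z ∂discArea) ≤
      C * μ Set.univ * hardySq f := by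
  obtain ⟨C, hC, h⟩ := exists_weighted_carleson_le
  refine ⟨C, hC, ?_⟩
  intro μ _ f hf r hr
  have hCμ : C * μ Set.univ ≠ ⊤ := ENNReal.mul_ne_top hC (measure_ne_top μ _)
  set R : ℕ → ℝ := fun n => 1 - 1 / ((n : ℝ) + 2) with hRdef
  have hRm : Monotone R := by
    intro m n hmn
    have : 1 / ((n : ℝ) + 2) ≤ 1 / ((m : ℝ) + 2) := by gcongr
    simp only [hRdef]
    linarith
  have hR : ∀ n, 0 < R n ∧ R n < 1 := by
    intro n
    have h1 : 1 / ((n : ℝ) + 2) < 1 := by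
      rw [div_lt_one (by positivity)]
      have : (0 : ℝ) ≤ n := Nat.cast_nonneg n
      linarith
    have h2 : 0 < 1 / ((n : ℝ) + 2) := by positivity
    simp only [hRdef]
    exact ⟨by linarith, by linarith⟩
  have hFm : Measurable (Function.uncurry fun (θ : ℝ) (z : ℂ) =>
      ‖zeroExt f (z, circleMap 0 r θ)‖ₑ ^ 2 * weight μ z) :=
    (((measurable_zeroExt hf).comp (by fun_prop :
      Measurable fun q : ℝ × ℂ => (q.2, circleMap 0 r q.1))).enorm.pow_const 2).mul
      ((measurable_weight μ).comp measurable_snd)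
  have hunion (θ : ℝ) : ∫⁻ z in Metric.ball (0 : ℂ) 1,
      ‖zeroExt f (z, circleMap 0 r θ)‖ₑ ^ 2 * weight μ z =
      ⨆ n, ∫⁻ z in Metric.ball (0 : ℂ) (R n),
        ‖zeroExt f (z, circleMap 0 r θ)‖ₑ ^ 2 * weight μ z := by
    rw [ball_eq_iUnion_ball, setLIntegral_iUnion_of_directed]
    exact (Monotone.directed_le fun m n hmn => Metric.ball_subset_ball (hRm hmn))
  have hle (θ : ℝ) : ∫⁻ z, ‖zeroExt f (z, circleMap 0 r θ)‖ₑ ^ 2 * weight μ z ∂discArea ≤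
      ⨆ n, ∫⁻ z in Metric.ball (0 : ℂ) (R n),
        ‖zeroExt f (z, circleMap 0 r θ)‖ₑ ^ 2 * weight μ z := by
    rw [← hunion, discArea, lintegral_smul_measure, smul_eq_mul]
    refine mul_le_of_le_one_left zero_le (ENNReal.inv_le_one.2 ?_)
    rw [← ENNReal.ofReal_one]
    exact ENNReal.ofReal_le_ofReal (by linarith [Real.pi_gt_three])
  refine (circleMean_mono hle).trans ?_
  rw [circleMean_iSup]
  · refine iSup_le fun n => ?_
    -- `ρ > R n` serves the embedding; `ρ > r` serves the comparison with `hardySq`.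
    obtain ⟨ρ, hρ1, hρ2⟩ := exists_between (max_lt (hR n).2 hr.2)
    refine le_trans (circleMean_mono fun θ => h μ _ ((measurable_zeroExt hf).comp (by fun_prop))
      (hf.slice_fst (circle_mem hr θ)) (R n) ρ (hR n).1
      ((le_max_left _ _).trans_lt hρ1) hρ2) ?_
    rw [circleMean_const_mul hCμ]
    gcongr
    exact circleMean_circleMean_le_hardySq hf hr.1 ((le_max_right _ _).trans hρ1.le) hρ2
  · intro n
    exact Measurable.lintegral_prod_right hFm
  · intro m n hmn θ
    exact lintegral_mono_set (Metric.ball_subset_ball (hRm hmn))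

/-! ### Norm estimates for the first coordinate. -/

/-- Multiplication by the first coordinate. -/
def mulFst : (bidisc → ℂ) →ₗ[ℂ] bidisc → ℂ where
  toFun f z := z.1.1 * f z
  map_add' f g := by ext z; simp [mul_add]
  map_smul' c f := by ext z; simp [mul_left_comm]

/-- Exchange of the two variables. -/
def swapVars : (bidisc → ℂ) →ₗ[ℂ] bidisc → ℂ where
  toFun f z := f ⟨z.1.swap, z.2.2, z.2.1⟩
  map_add' _ _ := rfl
  map_smul' _ _ := rfl

theorem zeroExt_mulFst (f : bidisc → ℂ) : zeroExt (mulFst f) = fun z => z.1 * zeroExt f z := by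
  ext z
  by_cases hz : z ∈ bidisc <;> simp [zeroExt, hz, mulFst]

theorem IsHolo.mulFst {f : bidisc → ℂ} (hf : IsHolo f) : IsHolo (mulFst f) := by
  unfold IsHolo
  rw [zeroExt_mulFst]
  exact differentiableOn_fst.mul hf

theorem fderiv_zeroExt_mulFst {f : bidisc → ℂ} (hf : IsHolo f) {z : ℂ × ℂ} (hz : z ∈ bidisc)
    (v : ℂ × ℂ) : fderiv ℂ (zeroExt (BidiscDirichlet.mulFst f)) z v =
      zeroExt f z * v.1 + z.1 * fderiv ℂ (zeroExt f) z v := by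
  rw [zeroExt_mulFst, fderiv_fun_mul differentiableAt_fst (hf.differentiableAt hz)]
  simp [fderiv_fst, add_comm]

theorem partial₁_mulFst {f : bidisc → ℂ} (hf : IsHolo f) {z : ℂ × ℂ} (hz : z ∈ bidisc) :
    partial₁ (mulFst f) z = zeroExt f z + z.1 * partial₁ f z := by
  simp [partial₁, fderiv_zeroExt_mulFst hf hz]

theorem partial₂_mulFst {f : bidisc → ℂ} (hf : IsHolo f) {z : ℂ × ℂ} (hz : z ∈ bidisc) :
    partial₂ (mulFst f) z = z.1 * partial₂ f z := by
  simp [partial₂, fderiv_zeroExt_mulFst hf hz]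

theorem enorm_mul_le_of_mem_ball {z : ℂ} (hz : z ∈ Metric.ball (0 : ℂ) 1) (a : ℂ) :
    ‖z * a‖ₑ ≤ ‖a‖ₑ := by
  have h1 : ‖z‖ₑ ≤ 1 := by
    rw [← ofReal_norm, ← ENNReal.ofReal_one]
    exact ENNReal.ofReal_le_ofReal (mem_ball_zero_iff.1 hz).le
  rw [enorm_mul]
  exact mul_le_of_le_one_left zero_le h1

theorem hardySq_mulFst_le (f : bidisc → ℂ) : hardySq (mulFst f) ≤ hardySq f := by
  unfold hardySq
  refine iSup₂_mono fun r hr => circleMean_mono fun s => circleMean_mono fun t => ?_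
  rw [zeroExt_mulFst]
  gcongr
  exact enorm_mul_le_of_mem_ball (circle_mem hr s) _

theorem dirichlet₂_mulFst_le (μ : Measure ClosedDisc) {f : bidisc → ℂ} (hf : IsHolo f) :
    dirichlet₂ μ (mulFst f) ≤ dirichlet₂ μ f := by
  unfold dirichlet₂
  refine iSup₂_mono fun r hr => circleMean_mono fun θ =>
    lintegral_mono_ae (ae_discArea fun z hz => ?_)
  rw [partial₂_mulFst hf ⟨circle_mem hr θ, hz⟩]
  gcongr
  exact enorm_mul_le_of_mem_ball (circle_mem hr θ) _

/-- The product rule splits the derivative into `f`, absorbed by `hardySq` through the Carleson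
embedding, and `z₁ ∂₁ f`, absorbed by `dirichlet₁`. -/
theorem exists_dirichlet₁_mulFst_le (μ : Measure ClosedDisc) [IsFiniteMeasure μ] :
    ∃ C : ℝ≥0∞, C ≠ ⊤ ∧ ∀ f : bidisc → ℂ, IsHolo f →
      dirichlet₁ μ (mulFst f) ≤ C * hardySq f + C * dirichlet₁ μ f := by
  obtain ⟨C, hC, h⟩ := exists_mean_weight_le
  have hq := quadConst_of_pos one_pos
  set c := ENNReal.ofReal (1 + 1) with hc
  set d := ENNReal.ofReal (1 + 1⁻¹)
  have hCμ : C * μ Set.univ ≠ ⊤ := ENNReal.mul_ne_top hC (measure_ne_top μ _)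
  refine ⟨c * (C * μ Set.univ) + d,
    ENNReal.add_ne_top.2 ⟨ENNReal.mul_ne_top hq.hc hCμ, hq.hd⟩, fun f hf => ?_⟩
  refine iSup₂_le fun r hr => ?_
  refine (mean_add_le hq (measurable_weight μ)
    (F := fun θ z => zeroExt f (z, circleMap 0 r θ))
    (G := fun θ z => z * partial₁ f (z, circleMap 0 r θ)) ?_ ?_).trans ?_
  · exact (measurable_zeroExt hf).comp (by fun_prop :
      Measurable fun p : ℝ × ℂ => (p.2, circleMap 0 r p.1))
  · exact fun θ z hz => partial₁_mulFst hf ⟨hz, circle_mem hr θ⟩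
  · have h1 := h μ f hf r hr
    have h2 : (circleMean fun θ => ∫⁻ z, ‖z * partial₁ f (z, circleMap 0 r θ)‖ₑ ^ 2 *
        weight μ z ∂discArea) ≤ dirichlet₁ μ f := by
      refine le_trans (circleMean_mono fun θ => lintegral_mono_ae (ae_discArea fun z hz => ?_))
        (le_iSup₂_of_le r hr le_rfl)
      gcongr
      exact enorm_mul_le_of_mem_ball hz _
    calc _ ≤ c * (C * μ Set.univ * hardySq f) + d * dirichlet₁ μ f := by gcongr
      _ = c * (C * μ Set.univ) * hardySq f + d * dirichlet₁ μ f := by ring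
      _ ≤ _ := by gcongr; exacts [le_self_add, le_add_self]

theorem exists_normSq_mulFst_le (μ₁ μ₂ : Measure ClosedDisc) [IsFiniteMeasure μ₁] :
    ∃ K : ℝ≥0∞, K ≠ ⊤ ∧ ∀ f : bidisc → ℂ, IsHolo f →
      normSq μ₁ μ₂ (mulFst f) ≤ K * normSq μ₁ μ₂ f := by
  obtain ⟨C, hC, h⟩ := exists_dirichlet₁_mulFst_le μ₁
  refine ⟨1 + C, ENNReal.add_ne_top.2 ⟨ENNReal.one_ne_top, hC⟩, fun f hf => ?_⟩
  unfold normSq dirichletIntegral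
  calc _ ≤ hardySq f + ((C * hardySq f + C * dirichlet₁ μ₁ f) + dirichlet₂ μ₂ f) :=
        add_le_add (hardySq_mulFst_le f) (add_le_add (h f hf) (dirichlet₂_mulFst_le μ₂ hf))
    _ ≤ hardySq f + ((C * hardySq f + C * dirichlet₁ μ₁ f) + dirichlet₂ μ₂ f) +
          (dirichlet₁ μ₁ f + C * dirichlet₂ μ₂ f) := le_self_add
    _ = _ := by ring

/-! ### Exchange of the variables, and passage to bounded operators. -/

theorem zeroExt_swapVars (f : bidisc → ℂ) (z : ℂ × ℂ) :
    zeroExt (swapVars f) z = zeroExt f z.swap := by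
  have h : z.swap ∈ bidisc ↔ z ∈ bidisc := and_comm
  by_cases hz : z ∈ bidisc
  · simp [zeroExt, hz, h.2 hz, swapVars]
  · simp [zeroExt, hz, mt h.1 hz]

theorem zeroExt_swapVars_eq_comp (f : bidisc → ℂ) :
    zeroExt (swapVars f) = zeroExt f ∘ ContinuousLinearEquiv.prodComm ℂ ℂ ℂ :=
  funext fun z => zeroExt_swapVars f z

theorem IsHolo.swapVars {f : bidisc → ℂ} (hf : IsHolo f) : IsHolo (swapVars f) := by
  unfold IsHolo
  rw [zeroExt_swapVars_eq_comp]
  exact DifferentiableOn.comp (t := bidisc) hf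
    (ContinuousLinearEquiv.differentiableOn _) (fun z hz => ⟨hz.2, hz.1⟩)

theorem partial₁_swapVars (f : bidisc → ℂ) (z : ℂ × ℂ) :
    partial₁ (swapVars f) z = partial₂ f z.swap := by
  unfold partial₁ partial₂
  rw [zeroExt_swapVars_eq_comp, ContinuousLinearEquiv.comp_right_fderiv]
  rfl

theorem partial₂_swapVars (f : bidisc → ℂ) (z : ℂ × ℂ) :
    partial₂ (swapVars f) z = partial₁ f z.swap := by
  unfold partial₁ partial₂
  rw [zeroExt_swapVars_eq_comp, ContinuousLinearEquiv.comp_right_fderiv]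
  rfl

theorem normSq_swapVars (μ₁ μ₂ : Measure ClosedDisc) {f : bidisc → ℂ} (hf : IsHolo f) :
    normSq μ₁ μ₂ (swapVars f) = normSq μ₂ μ₁ f := by
  have h0 : hardySq (swapVars f) = hardySq f := by
    unfold hardySq
    refine iSup_congr fun r => iSup_congr fun _ => ?_
    simp only [zeroExt_swapVars, Prod.swap_prod_mk]
    exact circleMean_swap (F := fun s t => ‖zeroExt f (circleMap 0 r t, circleMap 0 r s)‖ₑ ^ 2)
      (((measurable_zeroExt hf).comp (by fun_prop :
        Measurable fun q : ℝ × ℝ => (circleMap 0 r q.2, circleMap 0 r q.1))).enorm.pow_const 2)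
  have h1 : dirichlet₁ μ₁ (swapVars f) = dirichlet₂ μ₁ f := by
    simp only [dirichlet₁, dirichlet₂, partial₁_swapVars, Prod.swap_prod_mk]
  have h2 : dirichlet₂ μ₂ (swapVars f) = dirichlet₁ μ₂ f := by
    simp only [dirichlet₁, dirichlet₂, partial₂_swapVars, Prod.swap_prod_mk]
  unfold normSq dirichletIntegral
  rw [h0, h1, h2, add_comm (dirichlet₂ _ _)]

theorem exists_continuousLinearMap (μ₁ μ₂ : Measure ClosedDisc) [IsFiniteMeasure μ₁]
    [IsFiniteMeasure μ₂] (T : (bidisc → ℂ) →ₗ[ℂ] bidisc → ℂ)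
    (hT : ∀ f, IsHolo f → IsHolo (T f)) {K : ℝ≥0∞} (hK : K ≠ ⊤)
    (hTK : ∀ f, IsHolo f → normSq μ₁ μ₂ (T f) ≤ K * normSq μ₁ μ₂ f) :
    ∃ M : DirichletSpace μ₁ μ₂ →L[ℂ] DirichletSpace μ₁ μ₂,
      ∀ (f : DirichletSpace μ₁ μ₂) (z : bidisc), M f z = T f.1 z := by
  have hfin (f : DirichletSpace μ₁ μ₂) : normSq μ₁ μ₂ f.1 < ⊤ := ENNReal.add_lt_top.2 f.2.2
  let L : DirichletSpace μ₁ μ₂ →ₗ[ℂ] DirichletSpace μ₁ μ₂ :=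
    { toFun := fun f => ⟨T f.1, hT _ f.2.1, ENNReal.add_lt_top.1
        ((hTK _ f.2.1).trans_lt (ENNReal.mul_lt_top hK.lt_top (hfin f)))⟩
      map_add' := fun f g => Subtype.ext (T.map_add f.1 g.1)
      map_smul' := fun c f => Subtype.ext (T.map_smul c f.1) }
  refine ⟨L.mkContinuous (Real.sqrt K.toReal) fun f => ?_, fun f z => rfl⟩
  change Real.sqrt (normSq μ₁ μ₂ (T f.1)).toReal ≤
    Real.sqrt K.toReal * Real.sqrt (normSq μ₁ μ₂ f.1).toReal
  rw [← Real.sqrt_mul ENNReal.toReal_nonneg, ← ENNReal.toReal_mul]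
  exact Real.sqrt_le_sqrt
    (ENNReal.toReal_mono (ENNReal.mul_ne_top hK (hfin f).ne) (hTK _ f.2.1))

end BidiscDirichlet

theorem mainTheorem6 (μ₁ μ₂ : MeasureTheory.Measure BidiscDirichlet.ClosedDisc)
    [MeasureTheory.IsFiniteMeasure μ₁] [MeasureTheory.IsFiniteMeasure μ₂] :
    (∃ M₁ : BidiscDirichlet.DirichletSpace μ₁ μ₂ →L[ℂ] BidiscDirichlet.DirichletSpace μ₁ μ₂,
      ∀ (f : BidiscDirichlet.DirichletSpace μ₁ μ₂) (z : BidiscDirichlet.bidisc),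
        M₁ f z = z.1.1 * f z) ∧
    (∃ M₂ : BidiscDirichlet.DirichletSpace μ₁ μ₂ →L[ℂ] BidiscDirichlet.DirichletSpace μ₁ μ₂,
      ∀ (f : BidiscDirichlet.DirichletSpace μ₁ μ₂) (z : BidiscDirichlet.bidisc),
        M₂ f z = z.1.2 * f z) := by
  open BidiscDirichlet in
  constructor
  · obtain ⟨K, hK, h⟩ := exists_normSq_mulFst_le μ₁ μ₂
    exact exists_continuousLinearMap μ₁ μ₂ mulFst (fun f hf => hf.mulFst) hK h
  · obtain ⟨K, hK, h⟩ := exists_normSq_mulFst_le μ₂ μ₁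
    -- Multiplication by `z₂` is multiplication by `z₁` conjugated by the exchange of variables,
    -- which preserves the norm while interchanging `μ₁` and `μ₂`; hence the estimate is taken for
    -- the measures in reverse order.
    refine exists_continuousLinearMap μ₁ μ₂ (swapVars ∘ₗ mulFst ∘ₗ swapVars)
      (fun f hf => hf.swapVars.mulFst.swapVars) hK fun f hf => ?_
    rw [LinearMap.comp_apply, LinearMap.comp_apply,
      normSq_swapVars μ₁ μ₂ hf.swapVars.mulFst, ← normSq_swapVars μ₂ μ₁ hf]
    exact h _ hf.swapVars
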